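/- Vectors carry the maximum norm $\|\cdot\|_\infty$, matrices the induced norm. Fix $t_0\in\mathbb R$ and agents $i\in\mathcal N=\{1,\dots,N\}$ with identical internal dynamics, $$\dot y_i=F_i(t,y_i,z_i)+\Gamma_i(t,w_i)u_i,\qquad \dot z_i=Z(t,z_i,y_i),\qquad w_i=W_i(y_i,z_i),$$ $y_i,u_i\in\mathbb R^m$, $z_i\in\mathbb R^n$, $w_i\in\mathbb R^{m_i}$, where $F_i$, $Z$, $\Gamma_i$ are defined for $t\ge t_0$, measurable in $t$, locally Lipschitz in the remaining variables and bounded on compact sets of the remaining variables uniformly in $t$; $W_i$ is locally Lipschitz; and all $\Gamma_i(t,w)$ are invertible with $\|\Gamma_i(t,w)^{-1}\|_\infty\le M_\Gamma$ for a constant $M_\Gamma$. Let $\mathcal G$ be an undirected connected graph (without self-loops) on $\mathcal N$ with diameter $d_{\mathcal G}$, let $\mathcal N_i$ be the set of neighbours of $i$, and consider the edge-wise funnel coupling $$u_i=\Gamma_i(t,w_i)^{-1}\sum_{j\in\mathcal N_i}\Big(\mu_{ij}^p\big(\nu_{ij}^p(t)/\psi_{ij}^p(t)\big)\Big)_{p=1}^m,\qquad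 \nu_{ij}=y_j-y_i,$$ where for all edges and all $p$: $\psi_{ij}^p=\psi_{ji}^p:[t_0,\infty)\to(0,\infty)$ is bounded and $C^1$ with bounded derivative; $\mu_{ij}^p:(-1,1)\to\mathbb R$ is continuous, $\mu_{ij}^p(s)\to\pm\infty$ as $s\to\pm1$, and $\mu_{ij}^p(-s)=-\mu_{ji}^p(s)$. Put $\Psi(t)=\max_p\max_{(j,i)}\psi_{ij}^p(t)$, the inner maximum over all edges ($\Psi=0$ if there are no edges or $m=0$). The perturbed blended dynamics, with state $(s,z_1,\dots,z_N)$ and input $(e_1,\dots,e_N)$, is $$\dot s=\tfrac1N\sum_{i=1}^N F_i(t,s+e_i,z_i),\qquad \dot z_i=Z(t,z_i,s+e_i),\quad i\in\mathcal N.$$ Assume that for every initial time $\tau\ge t_0$, all initial values and all locally absolutely continuous inputs $e_i$ with $\|e_i(t)\|_\infty\le d_{\mathcal G}\Psi(t)$ for $t\ge\tau$ it has a global solution (solutions are in the sense of Carathéodory). Assume moreover that the perturbed blended dynamics is $\delta$-ISS with $(\beta,\hat\gamma)$, $\beta\in\mathcal{KL}$, $\hat\gamma\in\mathcal K_\infty$: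 for every initial time $\tau\ge t_0$, all initial values and all locally essentially bounded measurable inputs it has a global solution, and any two solutions $x,\hat x$ on $[\tau,\infty)$ with such inputs $e,\hat e$ satisfy, for all $t\ge\tau$, $$\|\hat x(t)-x(t)\|_\infty\le\beta(\|\hat x(\tau)-x(\tau)\|_\infty,t-\tau)+\hat\gamma\Big(\sup_{s\in[\tau,t)}\|\hat e(s)-e(s)\|_\infty\Big).$$ Then for every decreasing function $w:[0,\infty)\to(0,1]$ with $\lim_{t\to\infty}w(t)=0$ there is $\gamma\in\mathcal K_\infty$ such that the following holds for every $\omega\in(t_0,\infty]$. Let $(y_i,z_i)_{i\in\mathcal N}$ be a solution on $[t_0,\omega)$ of the coupled agents with $|\nu_{ij}^p(t_0)|<\psi_{ij}^p(t_0)$ for all edges and all $p$, and let $(\tilde s,\tilde z)$ be a solution on $[t_0,\omega)$ of the reduced-order blended dynamics $$\dot{\tilde s}=\tfrac1N\sum_{i=1}^N F_i(t,\tilde s,\tilde z),\qquad \dot{\tilde z}=Z(t,\tilde z,\tilde s),\qquad \tilde s(t_0)=\tfrac1N\sum_{i=1}^N y_i(t_0).$$ Then, for all $i\in\mathcal N$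 and all $t\in[t_0,\omega)$, $$\left\|\begin{bmatrix}y_i(t)\\z_i(t)\end{bmatrix}-\begin{bmatrix}\tilde s(t)\\\tilde z(t)\end{bmatrix}\right\|_\infty\le\beta\Big(\max_j\|z_j(t_0)-\tilde z(t_0)\|_\infty,t-t_0\Big)+\gamma\Big(\sup_{s\in[t_0,t)}d_{\mathcal G}\Psi(s)w(t-s)\Big)+d_{\mathcal G}\Psi(t),$$ where suprema over the empty set are $0$. -/

import Mathlib

open Set Filter Topology MeasureTheory

/- Vectors `Fin m → ℝ` and products carry the maximum norm; square matrices carry the operator norm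
induced by the maximum norm. -/
attribute [local instance] Matrix.linftyOpNormedAddCommGroup

/-! ### Carathéodory solutions -/

/-- `x` is a Carathéodory solution of `x' = f (t, x)` on the interval `[τ, ω)`, `ω ≤ ∞`: it is
absolutely continuous on every compact subinterval and satisfies the equation almost everywhere. -/
def IsCaratheodorySolution {E : Type*} [NormedAddCommGroup E] [NormedSpace ℝ E]
    (f : ℝ → E → E) (τ : ℝ) (ω : EReal) (x : ℝ → E) : Prop :=
  (∀ T : ℝ, τ ≤ T → (T : EReal) < ω → AbsolutelyContinuousOnInterval x τ T) ∧
    ∀ᵐ t : ℝ, τ < t → (t : EReal) < ω → HasDerivAt x (f t (x t)) t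

/-! ### Comparison functions and incremental input-to-state stability -/

/-- Class `𝒦` (only the values on `[0, ∞)` matter). -/
structure IsClassK (γ : ℝ → ℝ) : Prop where
  continuousOn : ContinuousOn γ (Ici 0)
  strictMonoOn : StrictMonoOn γ (Ici 0)
  map_zero : γ 0 = 0

/-- Class `𝒦_∞`. -/
structure IsClassKInf (γ : ℝ → ℝ) : Prop extends IsClassK γ where
  unbounded : Tendsto γ atTop atTop

/-- Class `𝒦ℒ`: `β (·, s)` is of class `𝒦` and `β (r, ·)` decreases to `0`. -/
structure IsClassKL (β : ℝ → ℝ → ℝ) : Prop where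
  classK : ∀ s, 0 ≤ s → IsClassK (fun r => β r s)
  antitoneOn : ∀ r, 0 ≤ r → AntitoneOn (β r) (Ici 0)
  tendsto_zero : ∀ r, 0 ≤ r → Tendsto (β r) atTop (𝓝 0)

/-- Locally essentially bounded (Lebesgue) measurable inputs on `[τ, ∞)`. -/
def IsAdmissibleInput {U : Type*} [NormedAddCommGroup U] (τ : ℝ) (u : ℝ → U) : Prop :=
  AEStronglyMeasurable u (volume.restrict (Ici τ)) ∧
    ∀ T : ℝ, ∃ M : ℝ, ∀ᵐ t ∂(volume.restrict (Icc τ T)), ‖u t‖ ≤ M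

/-- The system `x' = f (t, x, u)`, defined for `t ≥ t₀`, is `δ`-ISS with `(β, γ')`: solutions exist
globally for all initial times `τ ≥ t₀`, initial values and admissible inputs, and any two of them
satisfy the incremental estimate. If the supremum of the input difference over `[τ, t)` is infinite,
the right-hand side of the estimate is infinite and nothing is required; the supremum over the empty
interval (`t = τ`) is `0`. -/
structure IsDeltaISS {E U : Type*} [NormedAddCommGroup E] [NormedSpace ℝ E] [NormedAddCommGroup U]
    (t₀ : ℝ) (f : ℝ → E → U → E) (β : ℝ → ℝ → ℝ) (γ' : ℝ → ℝ) : Prop where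
  classKL : IsClassKL β
  classKInf : IsClassKInf γ'
  complete : ∀ τ, t₀ ≤ τ → ∀ (x₀ : E) (u : ℝ → U), IsAdmissibleInput τ u →
    ∃ x : ℝ → E, x τ = x₀ ∧ IsCaratheodorySolution (fun t ξ => f t ξ (u t)) τ ⊤ x
  estimate : ∀ τ, t₀ ≤ τ → ∀ u u' : ℝ → U, IsAdmissibleInput τ u → IsAdmissibleInput τ u' →
    ∀ x x' : ℝ → E,
      IsCaratheodorySolution (fun t ξ => f t ξ (u t)) τ ⊤ x →
      IsCaratheodorySolution (fun t ξ => f t ξ (u' t)) τ ⊤ x' →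
      ∀ t, τ ≤ t → BddAbove ((fun s => ‖u' s - u s‖) '' Ico τ t) →
        ‖x' t - x t‖ ≤ β ‖x' τ - x τ‖ (t - τ) + γ' (sSup ((fun s => ‖u' s - u s‖) '' Ico τ t))

/-! ### Agents with identical internal dynamics -/

/-- The data of `N` agents
`yᵢ' = Fᵢ (t, yᵢ, zᵢ) + Γᵢ (t, wᵢ) uᵢ`, `zᵢ' = Z (t, zᵢ, yᵢ)`, `wᵢ = Wᵢ (yᵢ, zᵢ)`
with outputs `yᵢ ∈ ℝᵐ`, internal states `zᵢ ∈ ℝⁿ` and introspective outputs `wᵢ` of dimension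
`q i`. -/
structure AgentFamily (N m n : ℕ) where
  q : Fin N → ℕ
  F : Fin N → ℝ → (Fin m → ℝ) → (Fin n → ℝ) → (Fin m → ℝ)
  Z : ℝ → (Fin n → ℝ) → (Fin m → ℝ) → (Fin n → ℝ)
  Γ : (i : Fin N) → ℝ → (Fin (q i) → ℝ) → Matrix (Fin m) (Fin m) ℝ
  W : (i : Fin N) → (Fin m → ℝ) → (Fin n → ℝ) → (Fin (q i) → ℝ)

/-- Performance functions `ψ i j p` and coupling functions `μ i j p`. Only the values for neighbours
`i, j` matter. -/
structure EdgeDesign (N m : ℕ) where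
  ψ : Fin N → Fin N → Fin m → ℝ → ℝ
  μ : Fin N → Fin N → Fin m → ℝ → ℝ

namespace AgentFamily

variable {N m n : ℕ}

/-- Regularity of the open-loop dynamics: measurable in `t`, locally Lipschitz in the state, bounded
on compact sets uniformly in `t ≥ t₀`. -/
structure OpenLoopAssumption (A : AgentFamily N m n) (t₀ : ℝ) : Prop where
  F_meas : ∀ i y z, AEMeasurable (fun t => A.F i t y z) (volume.restrict (Ici t₀))
  F_lip : ∀ i t, t₀ ≤ t →
    LocallyLipschitz (fun x : (Fin m → ℝ) × (Fin n → ℝ) => A.F i t x.1 x.2)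
  F_bdd : ∀ i, ∀ K : Set ((Fin m → ℝ) × (Fin n → ℝ)), IsCompact K →
    ∃ M : ℝ, ∀ t, t₀ ≤ t → ∀ x ∈ K, ‖A.F i t x.1 x.2‖ ≤ M
  Z_meas : ∀ z y, AEMeasurable (fun t => A.Z t z y) (volume.restrict (Ici t₀))
  Z_lip : ∀ t, t₀ ≤ t →
    LocallyLipschitz (fun x : (Fin n → ℝ) × (Fin m → ℝ) => A.Z t x.1 x.2)
  Z_bdd : ∀ K : Set ((Fin n → ℝ) × (Fin m → ℝ)), IsCompact K →
    ∃ M : ℝ, ∀ t, t₀ ≤ t → ∀ x ∈ K, ‖A.Z t x.1 x.2‖ ≤ M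
  Γ_meas : ∀ i w a b, AEMeasurable (fun t => A.Γ i t w a b) (volume.restrict (Ici t₀))
  Γ_lip : ∀ i t, t₀ ≤ t → LocallyLipschitz (fun w => A.Γ i t w)
  Γ_bdd : ∀ i, ∀ K : Set (Fin (A.q i) → ℝ), IsCompact K →
    ∃ M : ℝ, ∀ t, t₀ ≤ t → ∀ w ∈ K, ‖A.Γ i t w‖ ≤ M
  W_lip : ∀ i, LocallyLipschitz (fun x : (Fin m → ℝ) × (Fin n → ℝ) => A.W i x.1 x.2)

/-- The gain matrices are invertible with uniformly bounded inverse. -/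
structure GainAssumption (A : AgentFamily N m n) (t₀ : ℝ) : Prop where
  isUnit : ∀ i t, t₀ ≤ t → ∀ w, IsUnit (A.Γ i t w)
  inv_bdd : ∃ M : ℝ, 0 < M ∧ ∀ i t, t₀ ≤ t → ∀ w, ‖(A.Γ i t w)⁻¹‖ ≤ M

/-- The edge-wise funnel coupling law
`uᵢ = Γᵢ (t, wᵢ)⁻¹ ∑_{j ∈ 𝒩ᵢ} (μ_ij^p ((y_j^p - y_i^p) / ψ_ij^p (t)))_p`. -/
noncomputable def funnelCoupling (A : AgentFamily N m n) (G : SimpleGraph (Fin N))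
    [DecidableRel G.Adj] (C : EdgeDesign N m) (t : ℝ) (y : Fin N → Fin m → ℝ) (i : Fin N)
    (w : Fin (A.q i) → ℝ) : Fin m → ℝ :=
  (A.Γ i t w)⁻¹.mulVec
    (∑ j ∈ G.neighborFinset i, fun p => C.μ i j p ((y j p - y i p) / C.ψ i j p t))

/-- The right-hand side of the closed loop of the agents and the coupling law; the state is
`(y, z)`. -/
noncomputable def closedLoop (A : AgentFamily N m n) (G : SimpleGraph (Fin N))
    [DecidableRel G.Adj] (C : EdgeDesign N m) (t : ℝ)
    (x : (Fin N → Fin m → ℝ) × (Fin N → Fin n → ℝ)) :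
    (Fin N → Fin m → ℝ) × (Fin N → Fin n → ℝ) :=
  (fun i => A.F i t (x.1 i) (x.2 i) +
      (A.Γ i t (A.W i (x.1 i) (x.2 i))).mulVec
        (A.funnelCoupling G C t x.1 i (A.W i (x.1 i) (x.2 i))),
   fun i => A.Z t (x.2 i) (x.1 i))

/-- The right-hand side of the perturbed blended dynamics with state `(s, z₁, …, z_N)` and input
`(e₁, …, e_N)`. -/
noncomputable def perturbedBlended (A : AgentFamily N m n) (t : ℝ)
    (x : (Fin m → ℝ) × (Fin N → Fin n → ℝ)) (e : Fin N → Fin m → ℝ) :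
    (Fin m → ℝ) × (Fin N → Fin n → ℝ) :=
  ((N : ℝ)⁻¹ • ∑ i, A.F i t (x.1 + e i) (x.2 i), fun i => A.Z t (x.2 i) (x.1 + e i))

/-- The right-hand side of the reduced-order blended dynamics with state `(s, z)`. -/
noncomputable def reducedBlended (A : AgentFamily N m n) (t : ℝ)
    (x : (Fin m → ℝ) × (Fin n → ℝ)) : (Fin m → ℝ) × (Fin n → ℝ) :=
  ((N : ℝ)⁻¹ • ∑ i, A.F i t x.1 x.2, A.Z t x.2 x.1)

end AgentFamily

namespace EdgeDesign

variable {N m : ℕ}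

/-- The requirements on the performance and coupling functions on the edges of `G`. The coupling
functions are constrained on `(-1, 1)` only; their values elsewhere are arbitrary. -/
structure Admissible (C : EdgeDesign N m) (G : SimpleGraph (Fin N)) (t₀ : ℝ) : Prop where
  ψ_pos : ∀ i j, G.Adj i j → ∀ p t, t₀ ≤ t → 0 < C.ψ i j p t
  ψ_contDiff : ∀ i j, G.Adj i j → ∀ p, ContDiffOn ℝ 1 (C.ψ i j p) (Ici t₀)
  ψ_bdd : ∀ i j, G.Adj i j → ∀ p, ∃ M : ℝ, ∀ t, t₀ ≤ t → |C.ψ i j p t| ≤ M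
  ψ_deriv_bdd : ∀ i j, G.Adj i j → ∀ p, ∃ M : ℝ, ∀ t, t₀ ≤ t →
    |derivWithin (C.ψ i j p) (Ici t₀) t| ≤ M
  ψ_symm : ∀ i j, G.Adj i j → ∀ p t, t₀ ≤ t → C.ψ i j p t = C.ψ j i p t
  μ_cont : ∀ i j, G.Adj i j → ∀ p, ContinuousOn (C.μ i j p) (Ioo (-1) 1)
  μ_top : ∀ i j, G.Adj i j → ∀ p, Tendsto (C.μ i j p) (𝓝[<] 1) atTop
  μ_bot : ∀ i j, G.Adj i j → ∀ p, Tendsto (C.μ i j p) (𝓝[>] (-1)) atBot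
  μ_symm : ∀ i j, G.Adj i j → ∀ p, ∀ s ∈ Ioo (-1 : ℝ) 1, C.μ i j p (-s) = -C.μ j i p s

/-- `Ψ (t)`, the maximum of the performance functions over all edges and components (`0` if there
are none). -/
noncomputable def maxWidth (C : EdgeDesign N m) (G : SimpleGraph (Fin N)) (t : ℝ) : ℝ :=
  sSup {r | ∃ i j p, G.Adj i j ∧ r = C.ψ i j p t}

/-- All output differences over the edges lie inside their funnels at time `t`. -/
def InFunnel (C : EdgeDesign N m) (G : SimpleGraph (Fin N)) (t : ℝ)
    (y : Fin N → Fin m → ℝ) : Prop :=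
  ∀ i j, G.Adj i j → ∀ p, |y j p - y i p| < C.ψ i j p t

end EdgeDesign

/-- No finite escape time: for all initial times `τ ≥ t₀` and initial values, the perturbed blended
dynamics has a global solution for every (locally) absolutely continuous input `e` with
`‖eᵢ (t)‖ ≤ d_G Ψ (t)` for all `i` and `t ≥ τ`. -/
def NoFiniteEscape {N m n : ℕ} (A : AgentFamily N m n) (G : SimpleGraph (Fin N))
    (C : EdgeDesign N m) (t₀ : ℝ) : Prop :=
  ∀ τ, t₀ ≤ τ → ∀ e : ℝ → Fin N → Fin m → ℝ,
    (∀ T, τ ≤ T → AbsolutelyContinuousOnInterval e τ T) →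
    (∀ t, τ ≤ t → ∀ i, ‖e t i‖ ≤ G.diam * C.maxWidth G t) →
    ∀ x₀ : (Fin m → ℝ) × (Fin N → Fin n → ℝ), ∃ x : ℝ → (Fin m → ℝ) × (Fin N → Fin n → ℝ),
      x τ = x₀ ∧ IsCaratheodorySolution (fun t ξ => A.perturbedBlended t ξ (e t)) τ ⊤ x

/-!
The funnels are never left. If some output differences first reached the boundary at time `τ`,
orient these saturated edges from the larger to the smaller output; they form an acyclic graph,
which carries a flow whose net outflow decreases along every edge. The gaps to the funnel boundary,
weighted by this flow, are nonnegative before `τ` and vanish at `τ`; but every saturated edge pushes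
the derivative of the weighted gap to `+∞`, since the coupling force on it diverges while all other
terms stay bounded.

Inside the funnels the outputs are within `d_G Ψ` of their mean, and the antisymmetric coupling
forces cancel in its derivative. So the mean and the internal states solve the perturbed blended
dynamics with the output deviations as input, while the reduced-order solution, copied to all
agents, solves it with input `0`. Incremental stability applied on the window `[t - a, t)` bounds
their distance, up to the effect of the initial values, by `β (γ' M) a + γ' (r / w a)`, where `M`
bounds `d_G Ψ` and `r` is the discounted supremum. The infimum of these bounds over `a`, capped at
`γ' M`, is bounded and tends to `0` with `r`, so adding the identity to its concave majorant gives
`γ`.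
-/

/-! ### Absolutely continuous functions -/

section AbsolutelyContinuous

variable {X Y : Type*} [PseudoMetricSpace X] [PseudoMetricSpace Y] {a b c d : ℝ}

theorem absolutelyContinuousOnInterval_lipschitzWith_comp {f : ℝ → X}
    (hf : AbsolutelyContinuousOnInterval f a b) {K : NNReal} {φ : X → Y} (hφ : LipschitzWith K φ) :
    AbsolutelyContinuousOnInterval (fun t => φ (f t)) a b := by
  have h := Tendsto.const_mul (K : ℝ) hf
  rw [mul_zero] at h
  refine squeeze_zero (fun E => Finset.sum_nonneg fun i _ => dist_nonneg) (fun E => ?_) h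
  rw [Finset.mul_sum]
  exact Finset.sum_le_sum fun i _ => hφ.dist_le_mul _ _

theorem absolutelyContinuousOnInterval_congr {f g : ℝ → X}
    (hf : AbsolutelyContinuousOnInterval f a b) (h : EqOn f g (uIcc a b)) :
    AbsolutelyContinuousOnInterval g a b := by
  rw [absolutelyContinuousOnInterval_iff] at hf ⊢
  intro ε hε
  obtain ⟨δ, hδ, H⟩ := hf ε hε
  refine ⟨δ, hδ, fun E hE hl => ?_⟩
  refine lt_of_eq_of_lt (Finset.sum_congr rfl fun i hi => ?_) (H E hE hl)
  rw [h (hE.1 i hi).1, h (hE.1 i hi).2]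

theorem disjoint_uIoc_map_of_monotone {φ : ℝ → ℝ} (hφ : Monotone φ)
    (h : Disjoint (uIoc a b) (uIoc c d)) : Disjoint (uIoc (φ a) (φ b)) (uIoc (φ c) (φ d)) := by
  simp only [uIoc, Set.Ioc_disjoint_Ioc, ← hφ.map_min, ← hφ.map_max] at h ⊢
  exact hφ h

theorem absolutelyContinuousOnInterval_comp_monotone {f : ℝ → X}
    (hf : AbsolutelyContinuousOnInterval f a b) {K : NNReal} {φ : ℝ → ℝ} (hmono : Monotone φ)
    (hlip : LipschitzWith K φ) (hmaps : MapsTo φ (uIcc c d) (uIcc a b)) :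
    AbsolutelyContinuousOnInterval (fun t => f (φ t)) c d := by
  rw [absolutelyContinuousOnInterval_iff] at hf ⊢
  intro ε hε
  obtain ⟨δ, hδ, H⟩ := hf ε hε
  refine ⟨δ / (K + 1), by positivity, fun E hE hl => ?_⟩
  refine H (E.1, fun i => (φ (E.2 i).1, φ (E.2 i).2)) ⟨fun i hi => ?_, fun i hi j hj hij => ?_⟩ ?_
  · exact ⟨hmaps (hE.1 i hi).1, hmaps (hE.1 i hi).2⟩
  · exact disjoint_uIoc_map_of_monotone hmono (hE.2 hi hj hij)
  · rw [lt_div_iff₀ (by positivity)] at hl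
    calc ∑ i ∈ Finset.range E.1, dist (φ (E.2 i).1) (φ (E.2 i).2)
        ≤ ∑ i ∈ Finset.range E.1, (K + 1) * dist (E.2 i).1 (E.2 i).2 :=
          Finset.sum_le_sum fun i _ => (hlip.dist_le_mul _ _).trans (by gcongr; simp)
      _ < δ := by rwa [← Finset.mul_sum, mul_comm]

theorem absolutelyContinuousOnInterval_const (x : X) :
    AbsolutelyContinuousOnInterval (fun _ => x) a b :=
  (LipschitzWith.const x).lipschitzOnWith.absolutelyContinuousOnInterval

variable {F : Type*} [NormedAddCommGroup F]

theorem tendsto_nhdsLT_of_absolutelyContinuousOnInterval {f : ℝ → F} (hab : a < b)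
    (hf : AbsolutelyContinuousOnInterval f a b) : Tendsto f (𝓝[<] b) (𝓝 (f b)) := by
  have hcont := hf.continuousOn
  rw [uIcc_of_le hab.le] at hcont
  rw [← nhdsWithin_Ico_eq_nhdsLT hab]
  exact (hcont b (right_mem_Icc.2 hab.le)).tendsto.mono_left (nhdsWithin_mono _ Ico_subset_Icc_self)

/- With `φ = min · b` and `φ = max · b`, one has `f = f ∘ min + f ∘ max - f b`. -/
theorem absolutelyContinuousOnInterval_trans {f : ℝ → F}
    (hab : a ≤ b) (hbc : b ≤ c) (h₁ : AbsolutelyContinuousOnInterval f a b)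
    (h₂ : AbsolutelyContinuousOnInterval f b c) : AbsolutelyContinuousOnInterval f a c := by
  have hac := hab.trans hbc
  have hmin : AbsolutelyContinuousOnInterval (fun t => f (min t b)) a c := by
    refine absolutelyContinuousOnInterval_comp_monotone h₁ (monotone_id.min monotone_const)
      (LipschitzWith.id.min_const b) ?_
    rw [uIcc_of_le hac, uIcc_of_le hab]
    exact fun t ht => ⟨le_min ht.1 hab, min_le_right _ _⟩
  have hmax : AbsolutelyContinuousOnInterval (fun t => f (max t b)) a c := by
    refine absolutelyContinuousOnInterval_comp_monotone h₂ (monotone_id.max monotone_const)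
      (LipschitzWith.id.max_const b) ?_
    rw [uIcc_of_le hac, uIcc_of_le hbc]
    exact fun t ht => ⟨le_max_right _ _, max_le ht.2 hbc⟩
  refine absolutelyContinuousOnInterval_congr
    ((hmin.add hmax).sub (absolutelyContinuousOnInterval_const (f b))) fun t _ => ?_
  rcases le_total t b with h | h <;> simp [h]

theorem absolutelyContinuousOnInterval_finset_sum {ι : Type*} {f : ι → ℝ → F} (s : Finset ι)
    (h : ∀ i ∈ s, AbsolutelyContinuousOnInterval (f i) a b) :
    AbsolutelyContinuousOnInterval (fun t => ∑ i ∈ s, f i t) a b := by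
  classical
  induction s using Finset.induction_on with
  | empty => simpa using absolutelyContinuousOnInterval_const (0 : F)
  | insert i s his ih =>
    simp only [Finset.sum_insert his]
    exact (h i (by simp)).fun_add (ih fun j hj => h j (by simp [hj]))

theorem mul_sub_le_sub_of_ae_le_hasDerivAt {f f' : ℝ → ℝ} (hab : a ≤ b)
    (hf : AbsolutelyContinuousOnInterval f a b)
    (h : ∀ᵐ t : ℝ, t ∈ Ioo a b → HasDerivAt f (f' t) t ∧ c ≤ f' t) : c * (b - a) ≤ f b - f a := by
  have hle : ∀ᵐ t ∂volume.restrict (Icc a b), c ≤ deriv f t := by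
    rw [← restrict_Ioo_eq_restrict_Icc, ae_restrict_iff' measurableSet_Ioo]
    filter_upwards [h] with t ht hmem
    exact (ht hmem).1.deriv ▸ (ht hmem).2
  calc c * (b - a) = ∫ _ in a..b, c := by simp [mul_comm]
    _ ≤ ∫ t in a..b, deriv f t := intervalIntegral.integral_mono_ae_restrict hab
        intervalIntegrable_const hf.intervalIntegrable_deriv hle
    _ = f b - f a := hf.integral_deriv_eq_sub

theorem eventually_lt_of_tendsto_deriv_atTop {f f' : ℝ → ℝ} (hab : a < b)
    (hf : AbsolutelyContinuousOnInterval f a b)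
    (hderiv : ∀ᵐ t : ℝ, t ∈ Ioo a b → HasDerivAt f (f' t) t)
    (h : Tendsto f' (𝓝[<] b) atTop) : ∀ᶠ t in 𝓝[<] b, f t < f b := by
  obtain ⟨l, hl, hpos⟩ := (mem_nhdsLT_iff_exists_Ioo_subset' hab).1 (h.eventually_ge_atTop 1)
  filter_upwards [Ioo_mem_nhdsLT hl, Ioo_mem_nhdsLT hab] with t ht ht'
  have hsub : AbsolutelyContinuousOnInterval f t b := hf.mono <| by
    rw [uIcc_of_le ht'.2.le, uIcc_of_le hab.le]
    exact Icc_subset_Icc_left ht'.1.le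
  have hgrow : 1 * (b - t) ≤ f b - f t := by
    refine mul_sub_le_sub_of_ae_le_hasDerivAt (f' := f') ht'.2.le hsub ?_
    filter_upwards [hderiv] with s hs hmem
    exact ⟨hs ⟨ht'.1.trans hmem.1, hmem.2⟩, hpos ⟨ht.1.trans hmem.1, hmem.2⟩⟩
  linarith [ht'.2]

end AbsolutelyContinuous

/-! ### Continuous induction -/

theorem forall_mem_Icc_of_forall_mem_Ico {a b : ℝ} {P : ℝ → Prop}
    (hclosed : IsClosed {s ∈ Icc a b | ¬P s})
    (hstep : ∀ τ ∈ Icc a b, (∀ s ∈ Ico a τ, P s) → P τ) : ∀ s ∈ Icc a b, P s := by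
  by_contra! ⟨s, hs, hPs⟩
  have hbdd : BddBelow {s ∈ Icc a b | ¬P s} := ⟨a, fun _ h => h.1.1⟩
  have hmem := hclosed.csInf_mem ⟨s, hs, hPs⟩ hbdd
  refine hmem.2 (hstep _ hmem.1 fun r hr => ?_)
  by_contra hPr
  exact (csInf_le hbdd ⟨⟨hr.1, hr.2.le.trans hmem.1.2⟩, hPr⟩).not_gt hr.2

/-! ### Flows on acyclic graphs -/

/- The point of least norm in the convex hull of the vectors `b i` has the required property. -/
theorem exists_nonneg_forall_inner_sum_smul_pos {H ι : Type*} [NormedAddCommGroup H]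
    [InnerProductSpace ℝ H] [Fintype ι] (b : ι → H) (f : H →ₗ[ℝ] ℝ) (hf : ∀ i, 0 < f (b i)) :
    ∃ c : ι → ℝ, 0 ≤ c ∧ ∀ j, 0 < inner ℝ (∑ i, c i • b i) (b j) := by
  classical
  rcases isEmpty_or_nonempty ι with _ | _
  · exact ⟨0, le_rfl, isEmptyElim⟩
  let L : (ι → ℝ) →ₗ[ℝ] H := Fintype.linearCombination ℝ b
  have hconv : Convex ℝ (L '' stdSimplex ℝ ι) := (convex_stdSimplex ℝ ι).linear_image L
  have hcomplete : IsComplete (L '' stdSimplex ℝ ι) :=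
    ((isCompact_stdSimplex ℝ ι).image L.continuous_of_finiteDimensional).isComplete
  have hb : ∀ i, b i ∈ L '' stdSimplex ℝ ι := fun i =>
    ⟨Pi.single i 1, single_mem_stdSimplex ℝ i, by simp [L, Fintype.linearCombination_apply_single]⟩
  obtain ⟨x, ⟨c, hc, rfl⟩, hmin⟩ :=
    exists_norm_eq_iInf_of_complete_convex ⟨_, hb (Classical.arbitrary ι)⟩ hcomplete hconv 0
  rw [norm_eq_iInf_iff_real_inner_le_zero hconv ⟨c, hc, rfl⟩] at hmin
  have hne : L c ≠ 0 := by
    obtain ⟨i, -, hi⟩ := Finset.exists_ne_zero_of_sum_ne_zero (hc.2.trans_ne one_ne_zero)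
    have hpos : 0 < f (L c) := by
      simp only [L, Fintype.linearCombination_apply, map_sum, map_smul, smul_eq_mul]
      exact Finset.sum_pos' (fun j _ => mul_nonneg (hc.1 j) (hf j).le)
        ⟨i, Finset.mem_univ i, mul_pos ((hc.1 i).lt_of_ne' hi) (hf i)⟩
    rintro h
    simp [h] at hpos
  refine ⟨c, hc.1, fun j => ?_⟩
  change 0 < inner ℝ (L c) (b j)
  have hj := hmin (b j) (hb j)
  rw [zero_sub, inner_neg_left, inner_sub_right, real_inner_self_eq_norm_sq] at hj
  have : 0 < ‖L c‖ ^ 2 := by positivity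
  linarith

section Flow

variable {V ι : Type*} [DecidableEq V] [Fintype ι]

/-- The net outflow at each vertex of the flow `c` on the directed multigraph with edges `ι`, where
the edge `e` leads from `src e` to `tgt e`. -/
def netOutflow (src tgt : ι → V) (c : ι → ℝ) : V → ℝ :=
  ∑ e, c e • (Pi.single (src e) 1 - Pi.single (tgt e) 1)

theorem netOutflow_dotProduct [Fintype V] (src tgt : ι → V) (c : ι → ℝ) (v : V → ℝ) :
    netOutflow src tgt c ⬝ᵥ v = ∑ e, c e * (v (src e) - v (tgt e)) := by
  simp [netOutflow, sum_dotProduct, sub_dotProduct]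

theorem exists_flow_netOutflow_lt [Finite V] {src tgt : ι → V} {h : V → ℝ}
    (hh : ∀ e, h (tgt e) < h (src e)) :
    ∃ c : ι → ℝ, 0 ≤ c ∧ ∀ e, netOutflow src tgt c (tgt e) < netOutflow src tgt c (src e) := by
  have := Fintype.ofFinite V
  let b : ι → EuclideanSpace ℝ V := fun e =>
    WithLp.toLp 2 (Pi.single (src e) 1 - Pi.single (tgt e) 1)
  have hb : ∀ v e, inner ℝ (WithLp.toLp 2 v : EuclideanSpace ℝ V) (b e) = v (src e) - v (tgt e) :=
    fun v e => by simp [b, inner_sub_right, EuclideanSpace.inner_single_right]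
  obtain ⟨c, hc, hpos⟩ := exists_nonneg_forall_inner_sum_smul_pos b
    (innerₛₗ ℝ (WithLp.toLp 2 h)) fun e => by simpa [hb] using hh e
  have hsum : ∑ e, c e • b e = WithLp.toLp 2 (netOutflow src tgt c) := by
    simp [b, netOutflow]
  refine ⟨c, hc, fun e => ?_⟩
  simpa [hsum, hb] using hpos e

end Flow

theorem sum_mul_sum_of_antisymm {V : Type*} [Fintype V] (x : V → ℝ) (φ : V → V → ℝ)
    (h : ∀ i k, φ i k = -φ k i) :
    ∑ i, x i * ∑ k, φ i k = 2⁻¹ * ∑ i, ∑ k, (x i - x k) * φ i k := by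
  have hswap : ∑ i, ∑ k, x k * φ i k = -∑ i, x i * ∑ k, φ i k := by
    simp only [Finset.mul_sum, ← Finset.sum_neg_distrib]
    rw [Finset.sum_comm]
    exact Finset.sum_congr rfl fun i _ => Finset.sum_congr rfl fun k _ => by rw [h k i]; ring
  simp only [sub_mul, Finset.sum_sub_distrib, hswap, ← Finset.mul_sum]
  ring

theorem tendsto_finset_sum_atBot {α ι : Type*} {l : Filter α} {s : Finset ι} {f : ι → α → ℝ}
    (hb : ∀ i ∈ s, ∃ M, ∀ᶠ t in l, f i t ≤ M) {i₀ : ι} (hi₀ : i₀ ∈ s)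
    (h : Tendsto (f i₀) l atBot) : Tendsto (fun t => ∑ i ∈ s, f i t) l atBot := by
  classical
  choose! M hM using hb
  have hrest : ∀ᶠ t in l, ∀ i ∈ s.erase i₀, f i t ≤ M i :=
    (Finset.eventually_all _).2 fun i hi => hM i (Finset.mem_of_mem_erase hi)
  refine tendsto_atBot_mono' l ?_ (tendsto_atBot_add_const_right l (∑ i ∈ s.erase i₀, M i) h)
  filter_upwards [hrest] with t ht
  rw [← Finset.add_sum_erase s (fun i => f i t) hi₀]
  gcongr with i hi
  exact ht i hi

/-! ### Invariance of the funnels -/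

namespace EdgeDesign

variable {N m : ℕ} {C : EdgeDesign N m} {G : SimpleGraph (Fin N)} {t₀ τ : ℝ} {p : Fin m}

/-- The `p`-th component of the coupling force exerted on agent `i` by agent `k`; it vanishes
unless the agents are neighbours. -/
noncomputable def force (C : EdgeDesign N m) (G : SimpleGraph (Fin N)) [DecidableRel G.Adj]
    (p : Fin m) (t : ℝ) (y : Fin N → Fin m → ℝ) (i k : Fin N) : ℝ :=
  if G.Adj i k then C.μ i k p ((y k p - y i p) / C.ψ i k p t) else 0

/-- The edges on which the `p`-th output difference sits on the boundary of its funnel, oriented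
from the larger to the smaller output. -/
def saturatedEdges (C : EdgeDesign N m) (G : SimpleGraph (Fin N)) (p : Fin m) (t : ℝ)
    (y : Fin N → Fin m → ℝ) : Set (Fin N × Fin N) :=
  {e | G.Adj e.1 e.2 ∧ y e.1 p - y e.2 p = C.ψ e.1 e.2 p t}

theorem InFunnel.div_mem_Ioo {t : ℝ} {y : Fin N → Fin m → ℝ} (h : C.InFunnel G t y) {i k : Fin N}
    (hik : G.Adj i k) (p : Fin m) : (y k p - y i p) / C.ψ i k p t ∈ Ioo (-1 : ℝ) 1 := by
  have hlt := h i k hik p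
  have hψ : 0 < C.ψ i k p t := (abs_nonneg _).trans_lt hlt
  rwa [mem_Ioo, ← abs_lt, abs_div, abs_of_pos hψ, div_lt_one hψ]

theorem Admissible.force_antisymm [DecidableRel G.Adj] (hC : C.Admissible G t₀) (p : Fin m) {t : ℝ}
    (ht : t₀ ≤ t) {y : Fin N → Fin m → ℝ} (h : C.InFunnel G t y) (i k : Fin N) :
    C.force G p t y i k = -C.force G p t y k i := by
  unfold force
  by_cases hik : G.Adj i k
  · rw [if_pos hik, if_pos hik.symm, ← hC.μ_symm i k hik p _ (h.div_mem_Ioo hik.symm p),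
      hC.ψ_symm i k hik p t ht, ← neg_div, neg_sub]
  · rw [if_neg hik, if_neg fun h => hik h.symm, neg_zero]

section Boundary

variable {y : ℝ → Fin N → Fin m → ℝ} {i k : Fin N}

theorem Admissible.tendsto_div (hC : C.Admissible G t₀) (hτ : t₀ < τ)
    (hy : Tendsto y (𝓝[<] τ) (𝓝 (y τ))) (hik : G.Adj i k) :
    Tendsto (fun t => (y t k p - y t i p) / C.ψ i k p t) (𝓝[<] τ)
      (𝓝 ((y τ k p - y τ i p) / C.ψ i k p τ)) := by
  have hψ : ContinuousAt (C.ψ i k p) τ :=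
    (hC.ψ_contDiff i k hik p).continuousOn.continuousAt (Ici_mem_nhds hτ)
  have hcomp : ∀ j, Tendsto (fun t => y t j p) (𝓝[<] τ) (𝓝 (y τ j p)) := fun j =>
    (hy.apply_nhds j).apply_nhds p
  exact ((hcomp k).sub (hcomp i)).div (hψ.tendsto.mono_left nhdsWithin_le_nhds)
    (hC.ψ_pos i k hik p τ hτ.le).ne'

theorem Admissible.div_mem_Ioo_of_notMem_saturatedEdges (hC : C.Admissible G t₀) (hτ : t₀ < τ)
    (hy : Tendsto y (𝓝[<] τ) (𝓝 (y τ))) (hfun : ∀ᶠ t in 𝓝[<] τ, C.InFunnel G t (y t))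
    (hadj : G.Adj i k) (hik : (i, k) ∉ C.saturatedEdges G p τ (y τ))
    (hki : (k, i) ∉ C.saturatedEdges G p τ (y τ)) :
    (y τ k p - y τ i p) / C.ψ i k p τ ∈ Ioo (-1 : ℝ) 1 := by
  have hψ := hC.ψ_pos i k hadj p τ hτ.le
  have hmem : (y τ k p - y τ i p) / C.ψ i k p τ ∈ Icc (-1 : ℝ) 1 :=
    isClosed_Icc.mem_of_tendsto (hC.tendsto_div hτ hy hadj)
      (hfun.mono fun _ h => Ioo_subset_Icc_self (h.div_mem_Ioo hadj p))
  refine ⟨hmem.1.lt_of_ne fun h => hik ⟨hadj, ?_⟩, hmem.2.lt_of_ne fun h => hki ⟨hadj.symm, ?_⟩⟩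
  · rw [eq_div_iff hψ.ne'] at h
    linarith
  · rwa [← hC.ψ_symm i k hadj p τ hτ.le, ← div_eq_one_iff_eq hψ.ne']

variable [DecidableRel G.Adj]

theorem Admissible.tendsto_force_atBot (hC : C.Admissible G t₀) (hτ : t₀ < τ)
    (hy : Tendsto y (𝓝[<] τ) (𝓝 (y τ))) (hfun : ∀ᶠ t in 𝓝[<] τ, C.InFunnel G t (y t))
    (h : (i, k) ∈ C.saturatedEdges G p τ (y τ)) :
    Tendsto (fun t => C.force G p t (y t) i k) (𝓝[<] τ) atBot := by
  obtain ⟨hik, hsat⟩ : G.Adj i k ∧ y τ i p - y τ k p = C.ψ i k p τ := h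
  have hlim := hC.tendsto_div (p := p) hτ hy hik
  rw [← neg_sub, hsat, neg_div, div_self (hC.ψ_pos i k hik p τ hτ.le).ne'] at hlim
  simp only [force, if_pos hik]
  exact (hC.μ_bot i k hik p).comp
    (tendsto_nhdsWithin_iff.2 ⟨hlim, hfun.mono fun _ h => (h.div_mem_Ioo hik p).1⟩)

theorem Admissible.tendsto_force_atTop (hC : C.Admissible G t₀) (hτ : t₀ < τ)
    (hy : Tendsto y (𝓝[<] τ) (𝓝 (y τ))) (hfun : ∀ᶠ t in 𝓝[<] τ, C.InFunnel G t (y t))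
    (h : (k, i) ∈ C.saturatedEdges G p τ (y τ)) :
    Tendsto (fun t => C.force G p t (y t) i k) (𝓝[<] τ) atTop := by
  refine (tendsto_neg_atBot_atTop.comp (hC.tendsto_force_atBot hτ hy hfun h)).congr' ?_
  filter_upwards [hfun, Ioo_mem_nhdsLT hτ] with t ht hmem
  exact (hC.force_antisymm p hmem.1.le ht i k).symm

theorem Admissible.exists_tendsto_force (hC : C.Admissible G t₀) (hτ : t₀ < τ)
    (hy : Tendsto y (𝓝[<] τ) (𝓝 (y τ))) (hfun : ∀ᶠ t in 𝓝[<] τ, C.InFunnel G t (y t))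
    (hik : (i, k) ∉ C.saturatedEdges G p τ (y τ)) (hki : (k, i) ∉ C.saturatedEdges G p τ (y τ)) :
    ∃ a, Tendsto (fun t => C.force G p t (y t) i k) (𝓝[<] τ) (𝓝 a) := by
  by_cases hadj : G.Adj i k
  · have hmem := hC.div_mem_Ioo_of_notMem_saturatedEdges hτ hy hfun hadj hik hki
    simp only [force, if_pos hadj]
    exact ⟨_, ((hC.μ_cont i k hadj p).continuousAt (Ioo_mem_nhds hmem.1 hmem.2)).tendsto.comp
      (hC.tendsto_div hτ hy hadj)⟩
  · exact ⟨0, by simp only [force, if_neg hadj, tendsto_const_nhds]⟩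

theorem Admissible.tendsto_dotProduct_force_atBot (hC : C.Admissible G t₀) (hτ : t₀ < τ)
    (hy : Tendsto y (𝓝[<] τ) (𝓝 (y τ))) (hfun : ∀ᶠ t in 𝓝[<] τ, C.InFunnel G t (y t))
    (hne : (C.saturatedEdges G p τ (y τ)).Nonempty) {x : Fin N → ℝ}
    (hx : ∀ e ∈ C.saturatedEdges G p τ (y τ), x e.2 < x e.1) :
    Tendsto (fun t => x ⬝ᵥ fun i => ∑ k, C.force G p t (y t) i k) (𝓝[<] τ) atBot := by
  have hsat : ∀ e ∈ C.saturatedEdges G p τ (y τ),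
      Tendsto (fun t => (x e.1 - x e.2) * C.force G p t (y t) e.1 e.2) (𝓝[<] τ) atBot :=
    fun e he => (hC.tendsto_force_atBot hτ hy hfun he).const_mul_atBot (sub_pos.2 (hx e he))
  have hbdd : ∀ e : Fin N × Fin N, ∃ M, ∀ᶠ t in 𝓝[<] τ,
      (x e.1 - x e.2) * C.force G p t (y t) e.1 e.2 ≤ M := by
    intro e
    by_cases he : e ∈ C.saturatedEdges G p τ (y τ)
    · exact ⟨0, (hsat e he).eventually_le_atBot 0⟩
    by_cases he' : e.swap ∈ C.saturatedEdges G p τ (y τ)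
    · exact ⟨0, ((hC.tendsto_force_atTop hτ hy hfun he').const_mul_atTop_of_neg
        (sub_neg.2 (hx _ he'))).eventually_le_atBot 0⟩
    obtain ⟨a, ha⟩ := hC.exists_tendsto_force hτ hy hfun he he'
    exact ⟨_, (ha.const_mul (x e.1 - x e.2)).eventually_le_const (lt_add_one _)⟩
  obtain ⟨e₀, he₀⟩ := hne
  have hsum := tendsto_finset_sum_atBot (fun e _ => hbdd e) (Finset.mem_univ e₀) (hsat e₀ he₀)
  refine (hsum.const_mul_atBot (inv_pos.2 two_pos)).congr' ?_
  filter_upwards [hfun, Ioo_mem_nhdsLT hτ] with t ht hmem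
  rw [dotProduct, sum_mul_sum_of_antisymm x _ (hC.force_antisymm p hmem.1.le ht),
    Fintype.sum_prod_type]

end Boundary

section WeightedGap

variable {ι : Type*} [Fintype ι] {src tgt : ι → Fin N} {c : ι → ℝ}

/-- The gaps between the funnel boundaries and the `p`-th output differences, summed over a family
of edges with weights `c`. -/
def weightedGap (C : EdgeDesign N m) (p : Fin m) (src tgt : ι → Fin N) (c : ι → ℝ) (t : ℝ)
    (y : Fin N → Fin m → ℝ) : ℝ :=
  ∑ e, c e * (C.ψ (src e) (tgt e) p t - (y (src e) p - y (tgt e) p))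

theorem weightedGap_eq (C : EdgeDesign N m) (p : Fin m) (src tgt : ι → Fin N) (c : ι → ℝ) (t : ℝ)
    (y : Fin N → Fin m → ℝ) : C.weightedGap p src tgt c t y =
      ∑ e, c e * C.ψ (src e) (tgt e) p t - netOutflow src tgt c ⬝ᵥ fun i => y i p := by
  simp only [weightedGap, netOutflow_dotProduct, mul_sub, Finset.sum_sub_distrib]

theorem InFunnel.weightedGap_nonneg {t : ℝ} {y : Fin N → Fin m → ℝ} (h : C.InFunnel G t y)
    (hadj : ∀ e, G.Adj (src e) (tgt e)) (hc : 0 ≤ c) : 0 ≤ C.weightedGap p src tgt c t y :=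
  Finset.sum_nonneg fun e _ => mul_nonneg (hc e) <| by
    linarith [neg_lt_of_abs_lt (h _ _ (hadj e) p)]

theorem Admissible.absolutelyContinuousOnInterval_weightedGap (hC : C.Admissible G t₀)
    (hadj : ∀ e, G.Adj (src e) (tgt e)) (hτ : t₀ ≤ τ) {y : ℝ → Fin N → Fin m → ℝ}
    (hy : AbsolutelyContinuousOnInterval y t₀ τ) :
    AbsolutelyContinuousOnInterval (fun t => C.weightedGap p src tgt c t (y t)) t₀ τ := by
  have hψ : ∀ e, AbsolutelyContinuousOnInterval (C.ψ (src e) (tgt e) p) t₀ τ := fun e =>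
    ((hC.ψ_contDiff _ _ (hadj e) p).mono
      (by simpa only [uIcc_of_le hτ] using Icc_subset_Ici_self)).absolutelyContinuousOnInterval
  have hcomp : ∀ i, AbsolutelyContinuousOnInterval (fun t => y t i p) t₀ τ := fun i =>
    absolutelyContinuousOnInterval_lipschitzWith_comp hy (φ := fun x : Fin N → Fin m → ℝ => x i p)
      ((LipschitzWith.eval p).comp (LipschitzWith.eval i))
  exact absolutelyContinuousOnInterval_finset_sum _ fun e _ =>
    .const_mul _ ((hψ e).fun_sub ((hcomp _).fun_sub (hcomp _)))

theorem Admissible.hasDerivAt_weightedGap (hC : C.Admissible G t₀)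
    (hadj : ∀ e, G.Adj (src e) (tgt e)) {t : ℝ} (ht : t₀ < t) {y : ℝ → Fin N → Fin m → ℝ}
    {y' : Fin N → Fin m → ℝ} (hy : HasDerivAt y y' t) :
    HasDerivAt (fun t => C.weightedGap p src tgt c t (y t))
      (∑ e, c e * deriv (C.ψ (src e) (tgt e) p) t - netOutflow src tgt c ⬝ᵥ fun i => y' i p) t := by
  have hψ : ∀ e, HasDerivAt (C.ψ (src e) (tgt e) p) (deriv (C.ψ (src e) (tgt e) p) t) t := fun e =>
    (((hC.ψ_contDiff _ _ (hadj e) p).differentiableOn one_ne_zero).differentiableAt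
      (Ici_mem_nhds ht)).hasDerivAt
  have hcomp : ∀ i, HasDerivAt (fun t => y t i p) (y' i p) t := fun i =>
    hasDerivAt_pi.1 (hasDerivAt_pi.1 hy i) p
  simp only [weightedGap_eq, dotProduct]
  exact .fun_sub (.fun_sum fun e _ => .const_mul _ (hψ e))
    (.fun_sum fun i _ => .const_mul _ (hcomp i))

theorem Admissible.isBigO_deriv_ψ (hC : C.Admissible G t₀) {i k : Fin N} (hik : G.Adj i k)
    (hτ : t₀ < τ) : deriv (C.ψ i k p) =O[𝓝[<] τ] (1 : ℝ → ℝ) := by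
  obtain ⟨M, hM⟩ := hC.ψ_deriv_bdd i k hik p
  refine Asymptotics.IsBigO.of_bound M ?_
  filter_upwards [Ioo_mem_nhdsLT hτ] with t ht
  simpa [derivWithin_of_mem_nhds (Ici_mem_nhds ht.1)] using hM t ht.1.le

theorem Admissible.tendsto_deriv_weightedGap_atTop [DecidableRel G.Adj] (hC : C.Admissible G t₀)
    (hadj : ∀ e, G.Adj (src e) (tgt e)) (hτ : t₀ < τ) {y g : ℝ → Fin N → Fin m → ℝ}
    (hy : Tendsto y (𝓝[<] τ) (𝓝 (y τ))) (hfun : ∀ᶠ t in 𝓝[<] τ, C.InFunnel G t (y t))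
    (hg : g =O[𝓝[<] τ] (1 : ℝ → ℝ)) (hne : (C.saturatedEdges G p τ (y τ)).Nonempty)
    (hx : ∀ e ∈ C.saturatedEdges G p τ (y τ),
      netOutflow src tgt c e.2 < netOutflow src tgt c e.1) :
    Tendsto (fun t => ∑ e, c e * deriv (C.ψ (src e) (tgt e) p) t -
      netOutflow src tgt c ⬝ᵥ fun i => g t i p + ∑ k, C.force G p t (y t) i k) (𝓝[<] τ) atTop := by
  have hψ : (fun t => ∑ e, c e * deriv (C.ψ (src e) (tgt e) p) t) =O[𝓝[<] τ] (1 : ℝ → ℝ) :=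
    .fun_sum fun e _ => (hC.isBigO_deriv_ψ (hadj e) hτ).const_mul_left _
  have hdrift : (fun t => netOutflow src tgt c ⬝ᵥ fun i => g t i p) =O[𝓝[<] τ] (1 : ℝ → ℝ) :=
    .fun_sum fun i _ => (Asymptotics.isBigO_pi.1 (Asymptotics.isBigO_pi.1 hg i) p).const_mul_left _
  obtain ⟨M, hM⟩ := (hψ.sub hdrift).bound
  have hbdd : ∀ᶠ t in 𝓝[<] τ, -M ≤ ∑ e, c e * deriv (C.ψ (src e) (tgt e) p) t -
      netOutflow src tgt c ⬝ᵥ fun i => g t i p := by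
    filter_upwards [hM] with t ht
    exact neg_le_of_abs_le (by simpa using ht)
  have hforce := tendsto_neg_atBot_atTop.comp (hC.tendsto_dotProduct_force_atBot hτ hy hfun hne hx)
  refine (tendsto_atTop_add_left_of_le' _ (-M) hbdd hforce).congr fun t => ?_
  change _ + -_ = _ - _ ⬝ᵥ ((fun i => g t i p) + fun i => ∑ k, C.force G p t (y t) i k)
  rw [dotProduct_add, sub_add_eq_sub_sub, sub_eq_add_neg (_ - _)]

end WeightedGap

/- A flow supported on the saturated edges whose net outflow decreases along them yields a weighted
gap that is nonnegative before `τ`, vanishes at `τ`, and yet has derivative tending to `+∞`. -/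
theorem Admissible.saturatedEdges_eq_empty [DecidableRel G.Adj] (hC : C.Admissible G t₀)
    (hτ : t₀ < τ) {y g : ℝ → Fin N → Fin m → ℝ} (hac : AbsolutelyContinuousOnInterval y t₀ τ)
    (hderiv : ∀ᵐ t : ℝ, t ∈ Ioo t₀ τ →
      HasDerivAt y (fun i p => g t i p + ∑ k, C.force G p t (y t) i k) t)
    (hg : g =O[𝓝[<] τ] (1 : ℝ → ℝ)) (hfun : ∀ᶠ t in 𝓝[<] τ, C.InFunnel G t (y t)) :
    C.saturatedEdges G p τ (y τ) = ∅ := by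
  by_contra hempty
  let S := C.saturatedEdges G p τ (y τ)
  have : Fintype S := Fintype.ofFinite S
  have hadj : ∀ e : S, G.Adj e.1.1 e.1.2 := fun e => e.2.1
  obtain ⟨c, hc, hlt⟩ := exists_flow_netOutflow_lt (src := fun e : S => e.1.1)
    (tgt := fun e : S => e.1.2) (h := fun i => y τ i p) fun e =>
      sub_pos.1 (e.2.2.symm ▸ hC.ψ_pos _ _ (hadj e) p τ hτ.le)
  let V : ℝ → ℝ := fun t => C.weightedGap p (fun e : S => e.1.1) (fun e : S => e.1.2) c t (y t)
  have hVτ : V τ = 0 := Finset.sum_eq_zero fun e _ => by rw [e.2.2, sub_self, mul_zero]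
  have hy := tendsto_nhdsLT_of_absolutelyContinuousOnInterval hτ hac
  have hVlt : ∀ᶠ t in 𝓝[<] τ, V t < V τ := eventually_lt_of_tendsto_deriv_atTop hτ
    (hC.absolutelyContinuousOnInterval_weightedGap hadj hτ.le hac)
    (hderiv.mono fun t ht hmem => hC.hasDerivAt_weightedGap hadj hmem.1 (ht hmem))
    (hC.tendsto_deriv_weightedGap_atTop hadj hτ hy hfun hg (nonempty_iff_ne_empty.2 hempty)
      fun e he => hlt ⟨e, he⟩)
  obtain ⟨t, hVt, ht⟩ := (hVlt.and hfun).exists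
  exact (hVt.trans_eq hVτ).not_ge (ht.weightedGap_nonneg hadj hc)

theorem Admissible.isClosed_setOf_not_inFunnel (hC : C.Admissible G t₀) {y : ℝ → Fin N → Fin m → ℝ}
    (hy : ContinuousOn y (Icc t₀ τ)) : IsClosed {s ∈ Icc t₀ τ | ¬C.InFunnel G s (y s)} := by
  have hset : {s ∈ Icc t₀ τ | ¬C.InFunnel G s (y s)} = ⋃ (i) (k) (_ : G.Adj i k) (p),
      {s ∈ Icc t₀ τ | C.ψ i k p s ≤ |y s k p - y s i p|} := by
    ext s
    simp only [InFunnel, mem_iUnion, mem_ofPred_eq, not_forall, not_lt, exists_prop]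
    grind
  rw [hset]
  refine isClosed_iUnion_of_finite fun i => isClosed_iUnion_of_finite fun k =>
    isClosed_iUnion_of_finite fun hik => isClosed_iUnion_of_finite fun p => ?_
  exact isClosed_Icc.isClosed_le ((hC.ψ_contDiff i k hik p).continuousOn.mono Icc_subset_Ici_self)
    (((continuous_apply_apply k p).comp_continuousOn hy).sub
      ((continuous_apply_apply i p).comp_continuousOn hy)).abs

theorem Admissible.inFunnel_of_saturatedEdges_eq_empty (hC : C.Admissible G t₀) (hτ : t₀ < τ)
    {y : ℝ → Fin N → Fin m → ℝ} (hy : Tendsto y (𝓝[<] τ) (𝓝 (y τ)))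
    (hfun : ∀ᶠ t in 𝓝[<] τ, C.InFunnel G t (y t))
    (hempty : ∀ p, C.saturatedEdges G p τ (y τ) = ∅) : C.InFunnel G τ (y τ) := by
  intro i k hik p
  have hψ := hC.ψ_pos i k hik p τ hτ.le
  have hmem := hC.div_mem_Ioo_of_notMem_saturatedEdges (p := p) hτ hy hfun hik
    (by simp [hempty]) (by simp [hempty])
  rwa [mem_Ioo, ← abs_lt, abs_div, abs_of_pos hψ, div_lt_one hψ] at hmem

end EdgeDesign

namespace AgentFamily

variable {N m n : ℕ} {A : AgentFamily N m n} {G : SimpleGraph (Fin N)} [DecidableRel G.Adj]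
  {C : EdgeDesign N m} {t₀ τ : ℝ}

theorem closedLoop_fst_apply {t : ℝ} (hΓ : ∀ i w, IsUnit (A.Γ i t w))
    (x : (Fin N → Fin m → ℝ) × (Fin N → Fin n → ℝ)) (i : Fin N) (p : Fin m) :
    (A.closedLoop G C t x).1 i p = A.F i t (x.1 i) (x.2 i) p + ∑ k, C.force G p t x.1 i k := by
  have hdet := (Matrix.isUnit_iff_isUnit_det _).1 (hΓ i (A.W i (x.1 i) (x.2 i)))
  simp only [closedLoop, funnelCoupling, Matrix.mulVec_mulVec, Matrix.mul_nonsing_inv _ hdet,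
    Matrix.one_mulVec, Pi.add_apply, Finset.sum_apply, EdgeDesign.force, ← Finset.sum_filter,
    SimpleGraph.neighborFinset_eq_filter]

theorem isBigO_F_comp
    (hF : ∀ i, ∀ K : Set ((Fin m → ℝ) × (Fin n → ℝ)), IsCompact K →
      ∃ M : ℝ, ∀ t, t₀ ≤ t → ∀ x ∈ K, ‖A.F i t x.1 x.2‖ ≤ M)
    (hτ : t₀ < τ) {y : ℝ → Fin N → Fin m → ℝ} {z : ℝ → Fin N → Fin n → ℝ}
    (hyz : ContinuousOn (fun t => (y t, z t)) (Icc t₀ τ)) :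
    (fun t i => A.F i t (y t i) (z t i)) =O[𝓝[<] τ] (1 : ℝ → ℝ) := by
  refine Asymptotics.isBigO_pi.2 fun i => ?_
  have hcomp : ContinuousOn (fun t => (y t i, z t i)) (Icc t₀ τ) :=
    (by fun_prop : Continuous fun x : (Fin N → Fin m → ℝ) × (Fin N → Fin n → ℝ) =>
      (x.1 i, x.2 i)).comp_continuousOn hyz
  obtain ⟨M, hM⟩ := hF i _ (isCompact_Icc.image_of_continuousOn hcomp)
  refine Asymptotics.IsBigO.of_bound M ?_
  filter_upwards [Ioo_mem_nhdsLT hτ] with t ht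
  simpa using hM t ht.1.le _ (mem_image_of_mem _ (Ioo_subset_Icc_self ht))

theorem inFunnel_of_isCaratheodorySolution
    (hF : ∀ i, ∀ K : Set ((Fin m → ℝ) × (Fin n → ℝ)), IsCompact K →
      ∃ M : ℝ, ∀ t, t₀ ≤ t → ∀ x ∈ K, ‖A.F i t x.1 x.2‖ ≤ M)
    (hΓ : ∀ i t, t₀ ≤ t → ∀ w, IsUnit (A.Γ i t w)) (hC : C.Admissible G t₀) {ω : EReal}
    {y : ℝ → Fin N → Fin m → ℝ} {z : ℝ → Fin N → Fin n → ℝ}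
    (hsol : IsCaratheodorySolution (A.closedLoop G C) t₀ ω fun t => (y t, z t))
    (h₀ : C.InFunnel G t₀ (y t₀)) {T : ℝ} (hT : t₀ ≤ T) (hTω : (T : EReal) < ω) :
    ∀ t ∈ Icc t₀ T, C.InFunnel G t (y t) := by
  have hcont : ContinuousOn (fun t => (y t, z t)) (Icc t₀ T) := by
    simpa only [uIcc_of_le hT] using (hsol.1 T hT hTω).continuousOn
  refine forall_mem_Icc_of_forall_mem_Ico
    (hC.isClosed_setOf_not_inFunnel (continuous_fst.comp_continuousOn hcont)) fun τ hτ hfun => ?_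
  rcases hτ.1.eq_or_lt with rfl | hlt
  · exact h₀
  have hτω : (τ : EReal) < ω := (EReal.coe_le_coe_iff.2 hτ.2).trans_lt hTω
  have hy : AbsolutelyContinuousOnInterval y t₀ τ :=
    absolutelyContinuousOnInterval_lipschitzWith_comp (hsol.1 τ hτ.1 hτω) LipschitzWith.prod_fst
  have hfun' : ∀ᶠ t in 𝓝[<] τ, C.InFunnel G t (y t) := by
    filter_upwards [Ico_mem_nhdsLT hlt] with t ht using hfun t ht
  refine hC.inFunnel_of_saturatedEdges_eq_empty hlt
    (tendsto_nhdsLT_of_absolutelyContinuousOnInterval hlt hy) hfun' fun p => ?_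
  refine hC.saturatedEdges_eq_empty hlt hy ?_
    (isBigO_F_comp hF hlt (hcont.mono (Icc_subset_Icc_right hτ.2))) hfun'
  filter_upwards [hsol.2] with t ht hmem
  have hderiv : HasDerivAt y (A.closedLoop G C t (y t, z t)).1 t :=
    (ht hmem.1 ((EReal.coe_lt_coe_iff.2 hmem.2).trans hτω)).fst
  refine hderiv.congr_deriv ?_
  ext i p
  exact closedLoop_fst_apply (hΓ · t hmem.1.le) (y t, z t) i p

end AgentFamily

/-! ### Comparison functions -/

theorem IsClassK.mono {γ : ℝ → ℝ} (h : IsClassK γ) {r s : ℝ} (hr : 0 ≤ r) (hrs : r ≤ s) :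
    γ r ≤ γ s :=
  h.strictMonoOn.monotoneOn hr (hr.trans hrs : (0 : ℝ) ≤ s) hrs

theorem IsClassK.nonneg {γ : ℝ → ℝ} (h : IsClassK γ) {r : ℝ} (hr : 0 ≤ r) : 0 ≤ γ r :=
  h.map_zero.symm.le.trans (h.mono le_rfl hr)

theorem IsClassK.exists_pos_forall_le {γ : ℝ → ℝ} (h : IsClassK γ) {ε : ℝ} (hε : 0 < ε) :
    ∃ η > 0, ∀ r ∈ Icc 0 η, γ r ≤ ε := by
  have hlim : Tendsto γ (𝓝[≥] 0) (𝓝 0) := by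
    simpa [ContinuousWithinAt, h.map_zero] using h.continuousOn 0 self_mem_Ici
  obtain ⟨η, hη, hsub⟩ := mem_nhdsGE_iff_exists_Icc_subset.1 (hlim.eventually_le_const hε)
  exact ⟨η, hη, hsub⟩

section ConcaveMajorant

variable {ρ : ℝ → ℝ} {a b B r : ℝ}

/-- The coefficients `(a, b)` of the nondecreasing affine functions `s ↦ a + b s` that are
nonnegative and dominate `ρ` on `[0, ∞)`. -/
def affineMajorants (ρ : ℝ → ℝ) : Set (ℝ × ℝ) :=
  {p | 0 ≤ p.1 ∧ 0 ≤ p.2 ∧ ∀ s, 0 ≤ s → ρ s ≤ p.1 + p.2 * s}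

/-- The least nonnegative nondecreasing concave function dominating `ρ` on `[0, ∞)`, as an infimum
of affine functions. The value is junk at negative arguments, and if `ρ` has no affine majorant. -/
noncomputable def concaveMajorant (ρ : ℝ → ℝ) (r : ℝ) : ℝ :=
  ⨅ p : affineMajorants ρ, p.1.1 + p.1.2 * r

theorem nonempty_affineMajorants (hB : ∀ s, 0 ≤ s → ρ s ≤ B) : Nonempty (affineMajorants ρ) :=
  ⟨(|B|, 0), abs_nonneg B, le_rfl, fun s hs => by simpa using (hB s hs).trans (le_abs_self B)⟩

theorem concaveMajorant_le (h : (a, b) ∈ affineMajorants ρ) (hr : 0 ≤ r) :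
    concaveMajorant ρ r ≤ a + b * r := by
  refine ciInf_le ⟨0, ?_⟩ (⟨(a, b), h⟩ : affineMajorants ρ)
  rintro _ ⟨p, rfl⟩
  have := p.2.1
  have := p.2.2.1
  positivity

variable (hB : ∀ s, 0 ≤ s → ρ s ≤ B)
include hB

theorem le_concaveMajorant (hr : 0 ≤ r) : ρ r ≤ concaveMajorant ρ r :=
  have := nonempty_affineMajorants hB
  le_ciInf fun p => p.2.2.2 r hr

theorem concaveOn_concaveMajorant : ConcaveOn ℝ (Ici 0) (concaveMajorant ρ) := by
  have := nonempty_affineMajorants hB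
  refine ⟨convex_Ici 0, fun r hr s hs a b ha hb hab => le_ciInf fun p => ?_⟩
  calc a • concaveMajorant ρ r + b • concaveMajorant ρ s
      ≤ a * (p.1.1 + p.1.2 * r) + b * (p.1.1 + p.1.2 * s) :=
        add_le_add (mul_le_mul_of_nonneg_left (concaveMajorant_le p.2 hr) ha)
          (mul_le_mul_of_nonneg_left (concaveMajorant_le p.2 hs) hb)
    _ = p.1.1 + p.1.2 * (a • r + b • s) := by
        simp only [smul_eq_mul]
        linear_combination p.1.1 * hab

theorem monotoneOn_concaveMajorant : MonotoneOn (concaveMajorant ρ) (Ici 0) := by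
  have := nonempty_affineMajorants hB
  refine fun r hr s _ hrs => le_ciInf fun p => (concaveMajorant_le p.2 hr).trans ?_
  have := p.2.2.1
  gcongr

theorem concaveMajorant_nonneg (hr : 0 ≤ r) : 0 ≤ concaveMajorant ρ r := by
  have := nonempty_affineMajorants hB
  refine le_ciInf fun p => ?_
  have := p.2.1
  have := p.2.2.1
  positivity

theorem mem_affineMajorants_of_forall_mem_Icc {ε η : ℝ} (hε : 0 ≤ ε) (hη : 0 < η)
    (h : ∀ s ∈ Icc 0 η, ρ s ≤ ε) : (ε, |B| / η) ∈ affineMajorants ρ := by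
  refine ⟨hε, by positivity, fun s hs => ?_⟩
  rcases le_total s η with hsη | hsη
  · exact (h s ⟨hs, hsη⟩).trans (le_add_of_nonneg_right (by positivity))
  · calc ρ s ≤ |B| := (hB s hs).trans (le_abs_self B)
      _ = |B| / η * η := by field_simp
      _ ≤ |B| / η * s := by gcongr
      _ ≤ ε + |B| / η * s := le_add_of_nonneg_left hε

variable (h₀ : ∀ ε > 0, ∃ η > 0, ∀ s ∈ Icc 0 η, ρ s ≤ ε)
include h₀

theorem concaveMajorant_zero : concaveMajorant ρ 0 = 0 := by
  refine le_antisymm (le_of_forall_gt_imp_ge_of_dense fun ε hε => ?_)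
    (concaveMajorant_nonneg hB le_rfl)
  obtain ⟨η, hη, h⟩ := h₀ ε hε
  simpa using concaveMajorant_le (mem_affineMajorants_of_forall_mem_Icc hB hε.le hη h) le_rfl

theorem continuousOn_concaveMajorant : ContinuousOn (concaveMajorant ρ) (Ici 0) := by
  refine (concaveOn_concaveMajorant hB).continuousOn_Ici ?_
  rw [ContinuousWithinAt, concaveMajorant_zero hB h₀]
  refine tendsto_order.2 ⟨fun a ha => ?_, fun ε hε => ?_⟩
  · filter_upwards [self_mem_nhdsWithin] with r hr
    exact ha.trans_le (concaveMajorant_nonneg hB hr)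
  · obtain ⟨η, hη, h⟩ := h₀ (ε / 2) (half_pos hε)
    have hlim : Tendsto (fun r : ℝ => ε / 2 + |B| / η * r) (𝓝[≥] 0) (𝓝 (ε / 2)) :=
      (Continuous.tendsto' (by fun_prop) 0 _ (by simp)).mono_left nhdsWithin_le_nhds
    filter_upwards [hlim.eventually_lt_const (half_lt_self hε), self_mem_nhdsWithin] with r hlt hr
    exact (concaveMajorant_le
      (mem_affineMajorants_of_forall_mem_Icc hB (half_pos hε).le hη h) hr).trans_lt hlt

theorem isClassKInf_add_concaveMajorant : IsClassKInf fun r => r + concaveMajorant ρ r where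
  continuousOn := continuousOn_id.add (continuousOn_concaveMajorant hB h₀)
  strictMonoOn := (strictMono_id.strictMonoOn _).add_monotone (monotoneOn_concaveMajorant hB)
  map_zero := by rw [concaveMajorant_zero hB h₀, add_zero]
  unbounded := tendsto_atTop_mono' _ ((eventually_ge_atTop 0).mono fun _ hr =>
    le_add_of_nonneg_right (concaveMajorant_nonneg hB hr)) tendsto_id

theorem exists_isClassKInf_ge : ∃ γ, IsClassKInf γ ∧ ∀ r, 0 ≤ r → ρ r ≤ γ r :=
  ⟨_, isClassKInf_add_concaveMajorant hB h₀, fun _ hr =>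
    (le_concaveMajorant hB hr).trans (le_add_of_nonneg_left hr)⟩

end ConcaveMajorant

/-! ### Carathéodory solutions and admissible inputs -/

section Solutions

variable {E U : Type*} [NormedAddCommGroup E] [NormedSpace ℝ E] [NormedAddCommGroup U]
  {f : ℝ → E → E} {τ τ' T : ℝ} {ω : EReal} {x : ℝ → E} {u : ℝ → U}

theorem IsCaratheodorySolution.restart (h : IsCaratheodorySolution f τ ω x) (hτ : τ ≤ τ') :
    IsCaratheodorySolution f τ' ω x := by
  refine ⟨fun T hT hTω => (h.1 T (hτ.trans hT) hTω).mono ?_, ?_⟩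
  · rw [uIcc_of_le hT, uIcc_of_le (hτ.trans hT)]
    exact Icc_subset_Icc_left hτ
  · filter_upwards [h.2] with t ht hlt
    exact ht (hτ.trans_lt hlt)

theorem IsCaratheodorySolution.mono_right {ω' : EReal} (h : IsCaratheodorySolution f τ ω x)
    (hω : ω' ≤ ω) : IsCaratheodorySolution f τ ω' x := by
  refine ⟨fun T hT hTω => h.1 T hT (hTω.trans_le hω), ?_⟩
  filter_upwards [h.2] with t ht hlt hlt'
  exact ht hlt (hlt'.trans_le hω)

theorem IsCaratheodorySolution.ite (hT : τ ≤ T) (hx : IsCaratheodorySolution f τ T x)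
    (hac : AbsolutelyContinuousOnInterval x τ T) {x₁ : ℝ → E}
    (hx₁ : IsCaratheodorySolution f T ω x₁) (hxT : x₁ T = x T) :
    IsCaratheodorySolution f τ ω fun t => if t ≤ T then x t else x₁ t := by
  set X : ℝ → E := fun t => if t ≤ T then x t else x₁ t
  have hleft : ∀ t, t ≤ T → X t = x t := fun t ht => if_pos ht
  have hright : ∀ t, T ≤ t → X t = x₁ t := fun t ht => by
    rcases ht.eq_or_lt with rfl | hlt
    · rw [hleft _ le_rfl, hxT]
    · exact if_neg hlt.not_ge
  have hXac : AbsolutelyContinuousOnInterval X τ T :=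
    absolutelyContinuousOnInterval_congr hac fun t ht => by
      rw [uIcc_of_le hT] at ht
      exact (hleft t ht.2).symm
  refine ⟨fun S hS hSω => ?_, ?_⟩
  · rcases le_total S T with hST | hTS
    · refine hXac.mono ?_
      rw [uIcc_of_le hS, uIcc_of_le hT]
      exact Icc_subset_Icc_right hST
    · refine absolutelyContinuousOnInterval_trans hT hTS hXac
        (absolutelyContinuousOnInterval_congr (hx₁.1 S hTS hSω) fun t ht => ?_)
      rw [uIcc_of_le hTS] at ht
      exact (hright t ht.1).symm
  · filter_upwards [hx.2, hx₁.2, Measure.ae_ne volume T] with t hlt hgt hne hτt htω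
    rcases lt_or_gt_of_ne hne with htT | hTt
    · rw [hleft t htT.le]
      refine (hlt hτt (EReal.coe_lt_coe_iff.2 htT)).congr_of_eventuallyEq ?_
      filter_upwards [Iio_mem_nhds htT] with s hs using hleft s (le_of_lt hs)
    · rw [hright t hTt.le]
      refine (hgt hTt htω).congr_of_eventuallyEq ?_
      filter_upwards [Ioi_mem_nhds hTt] with s hs using hright s (le_of_lt hs)

theorem IsCaratheodorySolution.map {F : Type*} [NormedAddCommGroup F] [NormedSpace ℝ F]
    {g : ℝ → F → F} (h : IsCaratheodorySolution f τ ω x) (L : E →L[ℝ] F)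
    (hL : ∀ t, τ < t → (t : EReal) < ω → L (f t (x t)) = g t (L (x t))) :
    IsCaratheodorySolution g τ ω fun t => L (x t) := by
  refine ⟨fun T hT hTω =>
    absolutelyContinuousOnInterval_lipschitzWith_comp (h.1 T hT hTω) L.lipschitz, ?_⟩
  filter_upwards [h.2] with t ht hlt hltω
  rw [← hL t hlt hltω]
  exact L.hasFDerivAt.comp_hasDerivAt t (ht hlt hltω)

theorem IsAdmissibleInput.restart (h : IsAdmissibleInput τ u) (hτ : τ ≤ τ') :
    IsAdmissibleInput τ' u := by
  refine ⟨h.1.mono_measure (Measure.restrict_mono (Ici_subset_Ici.2 hτ) le_rfl), fun T => ?_⟩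
  obtain ⟨M, hM⟩ := h.2 T
  exact ⟨M, ae_mono (Measure.restrict_mono (Icc_subset_Icc_left hτ) le_rfl) hM⟩

theorem isAdmissibleInput_zero : IsAdmissibleInput τ fun _ => (0 : U) :=
  ⟨aestronglyMeasurable_const, fun _ => ⟨0, by simp⟩⟩

theorem isAdmissibleInput_comp_min (hT : τ ≤ T) (hu : ContinuousOn u (Icc τ T)) :
    IsAdmissibleInput τ fun t => u (min t T) := by
  have hmaps : MapsTo (fun t => min t T) (Ici τ) (Icc τ T) := fun t ht =>
    ⟨le_min ht hT, min_le_right _ _⟩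
  obtain ⟨M, hM⟩ := isCompact_Icc.exists_bound_of_continuousOn hu
  refine ⟨(hu.comp (by fun_prop) hmaps).aestronglyMeasurable measurableSet_Ici,
    fun S => ⟨M, ?_⟩⟩
  rw [ae_restrict_iff' measurableSet_Icc]
  exact .of_forall fun t ht => hM _ (hmaps ht.1)

end Solutions

/-! ### Incremental stability with fading memory -/

/-- The supremum of the past values of `v` over `[t₀, t)`, where the value at time `s` is discounted
according to its age `t - s`; it is `0` for the empty interval. -/
noncomputable def fadingSup (v w : ℝ → ℝ) (t₀ t : ℝ) : ℝ :=
  sSup ((fun s => v s * w (t - s)) '' Ico t₀ t)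

section FadingSup

variable {v w : ℝ → ℝ} {t₀ t M : ℝ}

theorem fadingSup_nonneg (hw : ∀ a, 0 ≤ a → 0 < w a) (hv : ∀ s ∈ Ico t₀ t, 0 ≤ v s) :
    0 ≤ fadingSup v w t₀ t :=
  Real.sSup_nonneg <| by
    rintro _ ⟨s, hs, rfl⟩
    exact mul_nonneg (hv s hs) (hw _ (sub_nonneg.2 hs.2.le)).le

theorem le_fadingSup_div (hanti : AntitoneOn w (Ici 0)) (hw : ∀ a, 0 ≤ a → 0 < w a)
    (hv : ∀ s ∈ Ico t₀ t, v s ∈ Icc 0 M) {s a : ℝ} (hs : s ∈ Ico t₀ t) (hsa : t - s ≤ a) :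
    v s ≤ fadingSup v w t₀ t / w a := by
  have hts : 0 ≤ t - s := sub_nonneg.2 hs.2.le
  have hbdd : BddAbove ((fun s => v s * w (t - s)) '' Ico t₀ t) := by
    refine ⟨M * w 0, ?_⟩
    rintro _ ⟨r, hr, rfl⟩
    have htr : 0 ≤ t - r := sub_nonneg.2 hr.2.le
    exact mul_le_mul (hv r hr).2 (hanti self_mem_Ici htr htr) (hw _ htr).le
      ((hv r hr).1.trans (hv r hr).2)
  rw [le_div_iff₀ (hw a (hts.trans hsa))]
  calc v s * w a ≤ v s * w (t - s) :=
        mul_le_mul_of_nonneg_left (hanti hts (hts.trans hsa) hsa) (hv s hs).1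
    _ ≤ fadingSup v w t₀ t := le_csSup hbdd (mem_image_of_mem _ hs)

end FadingSup

/-- The best bound on the distance of two solutions with equal initial values whose inputs differ by
at most `M`, in terms of the discounted supremum `r` of that difference: the distance was at most
`γ' M` at time `t - a`, and since then the inputs have differed by at most `r / w a`. -/
noncomputable def fadingGain (β : ℝ → ℝ → ℝ) (γ' w : ℝ → ℝ) (M r : ℝ) : ℝ :=
  min (γ' M) (⨅ a : Ici (0 : ℝ), β (γ' M) a + γ' (r / w a))

section FadingGain

variable {β : ℝ → ℝ → ℝ} {γ' w : ℝ → ℝ} {M : ℝ}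

theorem fadingGain_le (hβ : IsClassKL β) (hγ' : IsClassK γ') (hw : ∀ a, 0 ≤ a → 0 < w a)
    (hM : 0 ≤ M) {r a : ℝ} (hr : 0 ≤ r) (ha : 0 ≤ a) :
    fadingGain β γ' w M r ≤ β (γ' M) a + γ' (r / w a) := by
  refine (min_le_right _ _).trans (ciInf_le ⟨0, ?_⟩ (⟨a, ha⟩ : Ici (0 : ℝ)))
  rintro _ ⟨⟨b, hb⟩, rfl⟩
  exact add_nonneg ((hβ.classK b hb).nonneg (hγ'.nonneg hM))
    (hγ'.nonneg (div_nonneg hr (hw b hb).le))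

theorem exists_pos_forall_fadingGain_le (hβ : IsClassKL β) (hγ' : IsClassK γ')
    (hw : ∀ a, 0 ≤ a → 0 < w a) (hM : 0 ≤ M) {ε : ℝ} (hε : 0 < ε) :
    ∃ η > 0, ∀ r ∈ Icc 0 η, fadingGain β γ' w M r ≤ ε := by
  obtain ⟨a, ha, hβa⟩ := ((eventually_ge_atTop 0).and
    ((hβ.tendsto_zero _ (hγ'.nonneg hM)).eventually_le_const (half_pos hε))).exists
  obtain ⟨η, hη, hγη⟩ := hγ'.exists_pos_forall_le (half_pos hε)
  have hwa := hw a ha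
  refine ⟨η * w a, by positivity, fun r hr => ?_⟩
  have hgain : γ' (r / w a) ≤ ε / 2 :=
    hγη _ ⟨div_nonneg hr.1 hwa.le, (div_le_iff₀ hwa).2 hr.2⟩
  linarith [fadingGain_le hβ hγ' hw hM hr.1 ha]

theorem exists_isClassKInf_ge_fadingGain (hβ : IsClassKL β) (hγ' : IsClassK γ')
    (hw : ∀ a, 0 ≤ a → 0 < w a) (hM : 0 ≤ M) :
    ∃ γ, IsClassKInf γ ∧ ∀ r, 0 ≤ r → fadingGain β γ' w M r ≤ γ r :=
  exists_isClassKInf_ge (B := γ' M) (fun _ _ => min_le_left _ _) fun _ hε =>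
    exists_pos_forall_fadingGain_le hβ hγ' hw hM hε

end FadingGain

namespace IsDeltaISS

variable {E U : Type*} [NormedAddCommGroup E] [NormedSpace ℝ E] [NormedAddCommGroup U]
  {t₀ τ t T M D : ℝ} {f : ℝ → E → U → E} {β : ℝ → ℝ → ℝ} {γ' w v : ℝ → ℝ} {u u' : ℝ → U}
  {x x' : ℝ → E}

theorem exists_extension (h : IsDeltaISS t₀ f β γ') (hT : t₀ ≤ T) (hu : IsAdmissibleInput t₀ u)
    (hx : IsCaratheodorySolution (fun t ξ => f t ξ (u t)) t₀ T x)
    (hac : AbsolutelyContinuousOnInterval x t₀ T) :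
    ∃ X : ℝ → E, IsCaratheodorySolution (fun t ξ => f t ξ (u t)) t₀ ⊤ X ∧
      EqOn X x (Icc t₀ T) := by
  obtain ⟨x₁, hx₁T, hx₁⟩ := h.complete T hT (x T) u (hu.restart hT)
  exact ⟨_, hx.ite hT hac hx₁ hx₁T, fun _ ht => if_pos ht.2⟩

theorem norm_sub_le_of_forall_norm_sub_le (h : IsDeltaISS t₀ f β γ') (hτ : t₀ ≤ τ) (hτt : τ ≤ t)
    (hu : IsAdmissibleInput τ u) (hu' : IsAdmissibleInput τ u')
    (hx : IsCaratheodorySolution (fun t ξ => f t ξ (u t)) τ ⊤ x)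
    (hx' : IsCaratheodorySolution (fun t ξ => f t ξ (u' t)) τ ⊤ x') (hD : 0 ≤ D)
    (hle : ∀ s ∈ Ico τ t, ‖u' s - u s‖ ≤ D) :
    ‖x' t - x t‖ ≤ β ‖x' τ - x τ‖ (t - τ) + γ' D := by
  have hbd : ∀ r ∈ (fun s => ‖u' s - u s‖) '' Ico τ t, r ≤ D := forall_mem_image.2 hle
  have hnonneg : ∀ r ∈ (fun s => ‖u' s - u s‖) '' Ico τ t, 0 ≤ r :=
    forall_mem_image.2 fun _ _ => norm_nonneg _
  refine (h.estimate τ hτ u u' hu hu' x x' hx hx' t hτt ⟨D, hbd⟩).trans ?_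
  gcongr
  exact h.classKInf.mono (Real.sSup_nonneg hnonneg) (Real.sSup_le hbd hD)

section EqualInitialValues

variable (h : IsDeltaISS t₀ f β γ') (hu : IsAdmissibleInput t₀ u) (hu' : IsAdmissibleInput t₀ u')
  (hx : IsCaratheodorySolution (fun t ξ => f t ξ (u t)) t₀ ⊤ x)
  (hx' : IsCaratheodorySolution (fun t ξ => f t ξ (u' t)) t₀ ⊤ x') (h₀ : x' t₀ = x t₀)
include h hu hu' hx hx' h₀

theorem norm_sub_le_gain (ht : t₀ ≤ t) (hM : 0 ≤ M) (hle : ∀ s ∈ Ico t₀ t, ‖u' s - u s‖ ≤ M) :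
    ‖x' t - x t‖ ≤ γ' M := by
  have hest := h.norm_sub_le_of_forall_norm_sub_le le_rfl ht hu hu' hx hx' hM hle
  rwa [h₀, sub_self, norm_zero, (h.classKL.classK _ (sub_nonneg.2 ht)).map_zero, zero_add] at hest

theorem norm_sub_le_of_window (ht : t₀ ≤ t) (hM : 0 ≤ M) (hD : 0 ≤ D)
    (hleM : ∀ s ∈ Ico t₀ t, ‖u' s - u s‖ ≤ M) {a : ℝ} (ha : 0 ≤ a)
    (hleD : ∀ s ∈ Ico t₀ t, t - s ≤ a → ‖u' s - u s‖ ≤ D) :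
    ‖x' t - x t‖ ≤ β (γ' M) a + γ' D := by
  rcases le_total t₀ (t - a) with hta | hta
  · have hpast : ‖x' (t - a) - x (t - a)‖ ≤ γ' M :=
      h.norm_sub_le_gain hu hu' hx hx' h₀ hta hM fun s hs => hleM s ⟨hs.1, by linarith [hs.2]⟩
    calc ‖x' t - x t‖ ≤ β ‖x' (t - a) - x (t - a)‖ (t - (t - a)) + γ' D :=
          h.norm_sub_le_of_forall_norm_sub_le hta (sub_le_self t ha) (hu.restart hta)
            (hu'.restart hta) (hx.restart hta) (hx'.restart hta) hD
            fun s hs => hleD s ⟨hta.trans hs.1, hs.2⟩ (by linarith [hs.1])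
      _ ≤ β (γ' M) a + γ' D := by
          rw [sub_sub_cancel]
          gcongr
          exact (h.classKL.classK a ha).mono (norm_nonneg _) hpast
  · have hgain : ‖x' t - x t‖ ≤ γ' D :=
      h.norm_sub_le_gain hu hu' hx hx' h₀ ht hD fun s hs => hleD s hs (by linarith [hs.1])
    exact hgain.trans (le_add_of_nonneg_left
      ((h.classKL.classK a ha).nonneg (h.classKInf.nonneg hM)))

theorem norm_sub_le_fadingGain (hanti : AntitoneOn w (Ici 0)) (hw : ∀ a, 0 ≤ a → 0 < w a)
    (ht : t₀ ≤ t) (hM : 0 ≤ M) (hv : ∀ s ∈ Ico t₀ t, ‖u' s - u s‖ ≤ v s)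
    (hvM : ∀ s ∈ Ico t₀ t, v s ≤ M) :
    ‖x' t - x t‖ ≤ fadingGain β γ' w M (fadingSup v w t₀ t) := by
  have hv₀ : ∀ s ∈ Ico t₀ t, 0 ≤ v s := fun s hs => (norm_nonneg _).trans (hv s hs)
  have hle : ∀ s ∈ Ico t₀ t, ‖u' s - u s‖ ≤ M := fun s hs => (hv s hs).trans (hvM s hs)
  refine le_min (h.norm_sub_le_gain hu hu' hx hx' h₀ ht hM hle) (le_ciInf fun a => ?_)
  exact h.norm_sub_le_of_window hu hu' hx hx' h₀ ht hM
    (div_nonneg (fadingSup_nonneg hw hv₀) (hw a a.2).le) hle a.2 fun s hs hsa =>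
      (hv s hs).trans (le_fadingSup_div hanti hw (fun r hr => ⟨hv₀ r hr, hvM r hr⟩) hs hsa)

end EqualInitialValues

theorem exists_fading_gain (h : IsDeltaISS t₀ f β γ') (hanti : AntitoneOn w (Ici 0))
    (hw : ∀ a, 0 ≤ a → 0 < w a) (hM : 0 ≤ M) :
    ∃ γ, IsClassKInf γ ∧ ∀ {T : ℝ} {u u' : ℝ → U} {x x' : ℝ → E} {v : ℝ → ℝ}, t₀ ≤ T →
      IsAdmissibleInput t₀ u → IsAdmissibleInput t₀ u' →
      IsCaratheodorySolution (fun t ξ => f t ξ (u t)) t₀ T x →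
      AbsolutelyContinuousOnInterval x t₀ T →
      IsCaratheodorySolution (fun t ξ => f t ξ (u' t)) t₀ T x' →
      AbsolutelyContinuousOnInterval x' t₀ T →
      (∀ s ∈ Ico t₀ T, ‖u' s - u s‖ ≤ v s) → (∀ s ∈ Ico t₀ T, v s ≤ M) →
      ‖x' T - x T‖ ≤ β ‖x' t₀ - x t₀‖ (T - t₀) + γ (fadingSup v w t₀ T) := by
  obtain ⟨γ, hγ, hle⟩ := exists_isClassKInf_ge_fadingGain h.classKL h.classKInf.toIsClassK hw hM
  refine ⟨γ, hγ, fun {T u u' x x' v} hT hu hu' hx hac hx' hac' hv hvM => ?_⟩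
  obtain ⟨X, hX, hXx⟩ := h.exists_extension hT hu hx hac
  obtain ⟨X', hX', hXx'⟩ := h.exists_extension hT hu' hx' hac'
  obtain ⟨Y, hY₀, hY⟩ := h.complete t₀ le_rfl (X t₀) u' hu'
  have hT₀ : t₀ ∈ Icc t₀ T := left_mem_Icc.2 hT
  have hTT : T ∈ Icc t₀ T := right_mem_Icc.2 hT
  have hinit : ‖X' T - Y T‖ ≤ β ‖x' t₀ - x t₀‖ (T - t₀) := by
    have hest := h.norm_sub_le_of_forall_norm_sub_le le_rfl hT hu' hu' hY hX' le_rfl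
      fun s _ => by rw [sub_self, norm_zero]
    rwa [h.classKInf.map_zero, add_zero, hY₀, hXx hT₀, hXx' hT₀] at hest
  have hinput : ‖Y T - X T‖ ≤ γ (fadingSup v w t₀ T) :=
    (h.norm_sub_le_fadingGain hu hu' hX hY hY₀ hanti hw hT hM hv hvM).trans
      (hle _ (fadingSup_nonneg hw fun s hs => (norm_nonneg _).trans (hv s hs)))
  rw [← hXx hTT, ← hXx' hTT]
  exact (norm_sub_le_norm_sub_add_norm_sub _ _ _).trans (add_le_add hinit hinput)

end IsDeltaISS

/-! ### Synchronisation inside the funnels -/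

theorem dist_le_diam_mul {V X : Type*} [Finite V] [PseudoMetricSpace X] {G : SimpleGraph V}
    (hG : G.Connected) {y : V → X} {R : ℝ} (hR : 0 ≤ R)
    (h : ∀ i j, G.Adj i j → dist (y i) (y j) ≤ R) (i j : V) :
    dist (y i) (y j) ≤ G.diam * R := by
  have hwalk : ∀ {i j : V} (q : G.Walk i j), dist (y i) (y j) ≤ q.length * R := by
    intro i j q
    induction q with
    | nil => simp
    | @cons i k j hik q ih =>
      rw [SimpleGraph.Walk.length_cons, Nat.cast_succ]
      linarith [dist_triangle (y i) (y k) (y j), h i k hik]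
  have := hG.nonempty
  obtain ⟨q, hq⟩ := hG.exists_walk_length_eq_dist i j
  have hlen : q.length ≤ G.diam :=
    hq ▸ SimpleGraph.dist_le_diam (SimpleGraph.connected_iff_ediam_ne_top.1 hG)
  exact (hwalk q).trans (by gcongr)

section Deviation

variable {N : ℕ} {E : Type*} [NormedAddCommGroup E] [NormedSpace ℝ E]

/-- The deviations of the vectors `y i` from their mean. -/
noncomputable def meanDeviation (y : Fin N → E) (i : Fin N) : E :=
  y i - (N : ℝ)⁻¹ • ∑ j, y j

theorem continuous_meanDeviation : Continuous (meanDeviation : (Fin N → E) → Fin N → E) := by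
  unfold meanDeviation
  fun_prop

theorem norm_meanDeviation_le_of_forall_dist_le {y : Fin N → E} {R : ℝ} {i : Fin N}
    (h : ∀ j, dist (y i) (y j) ≤ R) : ‖meanDeviation y i‖ ≤ R := by
  have hN : (0 : ℝ) < N := Nat.cast_pos.2 i.pos
  calc ‖meanDeviation y i‖ = ‖(N : ℝ)⁻¹ • ∑ j, (y i - y j)‖ := by
        rw [meanDeviation, Finset.sum_sub_distrib, smul_sub, Finset.sum_const, Finset.card_univ,
          Fintype.card_fin, ← Nat.cast_smul_eq_nsmul ℝ, inv_smul_smul₀ hN.ne']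
    _ = (N : ℝ)⁻¹ * ‖∑ j, (y i - y j)‖ := by rw [norm_smul, norm_inv, Real.norm_natCast]
    _ ≤ (N : ℝ)⁻¹ * ∑ _j : Fin N, R := by
        gcongr
        exact norm_sum_le_of_le _ fun j _ => (dist_eq_norm _ _).symm.trans_le (h j)
    _ = R := by simp [hN.ne']

end Deviation

namespace EdgeDesign

variable {N m : ℕ} {C : EdgeDesign N m} {G : SimpleGraph (Fin N)} {t₀ t : ℝ}
  {y : Fin N → Fin m → ℝ}

theorem le_maxWidth {i j : Fin N} (h : G.Adj i j) (p : Fin m) (t : ℝ) :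
    C.ψ i j p t ≤ C.maxWidth G t := by
  refine le_csSup (((Set.finite_range fun e : Fin N × Fin N × Fin m =>
    C.ψ e.1 e.2.1 e.2.2 t).subset ?_).bddAbove) ⟨i, j, p, h, rfl⟩
  rintro _ ⟨i, j, p, -, rfl⟩
  exact ⟨(i, j, p), rfl⟩

theorem Admissible.exists_maxWidth_le (hC : C.Admissible G t₀) :
    ∃ M, 0 ≤ M ∧ ∀ t, t₀ ≤ t → C.maxWidth G t ≤ M := by
  choose! B hB using hC.ψ_bdd
  have hnonneg : ∀ e : Fin N × Fin N × Fin m, 0 ≤ |B e.1 e.2.1 e.2.2| := fun _ => abs_nonneg _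
  refine ⟨∑ e : Fin N × Fin N × Fin m, |B e.1 e.2.1 e.2.2|, Finset.sum_nonneg fun e _ => hnonneg e,
    fun t ht => Real.sSup_le ?_ (Finset.sum_nonneg fun e _ => hnonneg e)⟩
  rintro _ ⟨i, j, p, h, rfl⟩
  calc C.ψ i j p t ≤ |B i j p| :=
        ((le_abs_self _).trans (hB i j h p t ht)).trans (le_abs_self _)
    _ ≤ ∑ e : Fin N × Fin N × Fin m, |B e.1 e.2.1 e.2.2| :=
        Finset.single_le_sum (fun e _ => hnonneg e) (Finset.mem_univ (i, j, p))

theorem InFunnel.maxWidth_nonneg (h : C.InFunnel G t y) : 0 ≤ C.maxWidth G t :=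
  Real.sSup_nonneg <| by
    rintro _ ⟨i, j, p, hij, rfl⟩
    exact (abs_nonneg _).trans (h i j hij p).le

theorem InFunnel.dist_le_maxWidth (h : C.InFunnel G t y) {i j : Fin N} (hij : G.Adj i j) :
    dist (y i) (y j) ≤ C.maxWidth G t :=
  (dist_pi_le_iff h.maxWidth_nonneg).2 fun p => by
    rw [dist_comm, Real.dist_eq]
    exact (h i j hij p).le.trans (le_maxWidth hij p t)

theorem InFunnel.norm_meanDeviation_le (h : C.InFunnel G t y) (hG : G.Connected) :
    ‖meanDeviation y‖ ≤ G.diam * C.maxWidth G t :=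
  (pi_norm_le_iff_of_nonneg (mul_nonneg (Nat.cast_nonneg _) h.maxWidth_nonneg)).2 fun i =>
    norm_meanDeviation_le_of_forall_dist_le <|
      dist_le_diam_mul hG h.maxWidth_nonneg (fun _ _ hij => h.dist_le_maxWidth hij) i

end EdgeDesign

/-! ### The blended dynamics -/

namespace AgentFamily

variable {N m n : ℕ} {A : AgentFamily N m n} {G : SimpleGraph (Fin N)} [DecidableRel G.Adj]
  {C : EdgeDesign N m} {t₀ t : ℝ} {ω : EReal}

theorem sum_closedLoop_fst (hΓ : ∀ i w, IsUnit (A.Γ i t w)) (hC : C.Admissible G t₀) (ht : t₀ ≤ t)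
    {x : (Fin N → Fin m → ℝ) × (Fin N → Fin n → ℝ)} (h : C.InFunnel G t x.1) :
    ∑ i, (A.closedLoop G C t x).1 i = ∑ i, A.F i t (x.1 i) (x.2 i) := by
  ext p
  have hforce : ∑ i, ∑ k, C.force G p t x.1 i k = 0 := by
    simpa using sum_mul_sum_of_antisymm (fun _ => (1 : ℝ)) _ (hC.force_antisymm p ht h)
  simp only [Finset.sum_apply, closedLoop_fst_apply hΓ, Finset.sum_add_distrib, hforce, add_zero]

/-- The projection `(y, z) ↦ (s, z)` onto the state of the blended dynamics, where `s` is the mean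
of the outputs. -/
noncomputable def meanMap (N m n : ℕ) : (Fin N → Fin m → ℝ) × (Fin N → Fin n → ℝ) →L[ℝ]
    (Fin m → ℝ) × (Fin N → Fin n → ℝ) :=
  ((N : ℝ)⁻¹ • ∑ i, (ContinuousLinearMap.proj i).comp (ContinuousLinearMap.fst ℝ _ _)).prod
    (ContinuousLinearMap.snd ℝ _ _)

theorem meanMap_apply (x : (Fin N → Fin m → ℝ) × (Fin N → Fin n → ℝ)) :
    meanMap N m n x = ((N : ℝ)⁻¹ • ∑ i, x.1 i, x.2) := by
  simp [meanMap]

/-- The embedding `(s, z) ↦ (s, z, …, z)` of the state of the reduced-order blended dynamics into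
that of the blended dynamics. -/
noncomputable def diagMap (N m n : ℕ) : (Fin m → ℝ) × (Fin n → ℝ) →L[ℝ]
    (Fin m → ℝ) × (Fin N → Fin n → ℝ) :=
  (ContinuousLinearMap.fst ℝ _ _).prod
    (ContinuousLinearMap.pi fun _ => ContinuousLinearMap.snd ℝ _ _)

theorem diagMap_apply (x : (Fin m → ℝ) × (Fin n → ℝ)) :
    diagMap N m n x = (x.1, fun _ => x.2) := rfl

theorem diagMap_reducedBlended (t : ℝ) (x : (Fin m → ℝ) × (Fin n → ℝ)) :
    diagMap N m n (A.reducedBlended t x) = A.perturbedBlended t (diagMap N m n x) 0 := by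
  simp [diagMap_apply, reducedBlended, perturbedBlended]

theorem meanMap_closedLoop (hΓ : ∀ i w, IsUnit (A.Γ i t w)) (hC : C.Admissible G t₀) (ht : t₀ ≤ t)
    {x : (Fin N → Fin m → ℝ) × (Fin N → Fin n → ℝ)} (h : C.InFunnel G t x.1) :
    meanMap N m n (A.closedLoop G C t x) =
      A.perturbedBlended t (meanMap N m n x) (meanDeviation x.1) := by
  rw [meanMap_apply, meanMap_apply, sum_closedLoop_fst hΓ hC ht h]
  simp [perturbedBlended, closedLoop, meanDeviation]

theorem isCaratheodorySolution_meanMap (hΓ : ∀ i t, t₀ ≤ t → ∀ w, IsUnit (A.Γ i t w))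
    (hC : C.Admissible G t₀) {y : ℝ → Fin N → Fin m → ℝ} {z : ℝ → Fin N → Fin n → ℝ}
    {u : ℝ → Fin N → Fin m → ℝ}
    (hsol : IsCaratheodorySolution (A.closedLoop G C) t₀ ω fun t => (y t, z t))
    (hfun : ∀ t, t₀ < t → (t : EReal) < ω → C.InFunnel G t (y t))
    (hu : ∀ t, t₀ < t → (t : EReal) < ω → u t = meanDeviation (y t)) :
    IsCaratheodorySolution (fun t ξ => A.perturbedBlended t ξ (u t)) t₀ ω
      fun t => meanMap N m n (y t, z t) :=
  hsol.map (meanMap N m n) fun t ht htω => by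
    rw [meanMap_closedLoop (hΓ · t ht.le) hC ht.le (hfun t ht htω), hu t ht htω]

theorem isCaratheodorySolution_diagMap {x : ℝ → (Fin m → ℝ) × (Fin n → ℝ)}
    (hx : IsCaratheodorySolution A.reducedBlended t₀ ω x) :
    IsCaratheodorySolution (fun t ξ => A.perturbedBlended t ξ 0) t₀ ω
      fun t => diagMap N m n (x t) :=
  hx.map (diagMap N m n) fun t _ _ => diagMap_reducedBlended t (x t)

theorem norm_sub_le_add_norm_meanMap_sub_diagMap (y : Fin N → Fin m → ℝ) (z : Fin N → Fin n → ℝ)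
    (s : Fin m → ℝ) (ζ : Fin n → ℝ) (i : Fin N) :
    ‖(y i, z i) - (s, ζ)‖ ≤
      ‖meanMap N m n (y, z) - diagMap N m n (s, ζ)‖ + ‖meanDeviation y‖ := by
  rw [meanMap_apply, diagMap_apply]
  refine max_le ?_ ?_
  · calc ‖y i - s‖ ≤ ‖(N : ℝ)⁻¹ • ∑ j, y j - s‖ + ‖meanDeviation y i‖ :=
          (norm_sub_le_norm_sub_add_norm_sub _ _ _).trans_eq (add_comm _ _)
      _ ≤ _ := add_le_add (norm_fst_le (((N : ℝ)⁻¹ • ∑ j, y j, z) - (s, fun _ => ζ)))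
          (norm_le_pi_norm _ i)
  · calc ‖z i - ζ‖ ≤ ‖z - fun _ => ζ‖ := norm_le_pi_norm (z - fun _ => ζ) i
      _ ≤ ‖((N : ℝ)⁻¹ • ∑ j, y j, z) - (s, fun _ => ζ)‖ :=
          norm_snd_le (((N : ℝ)⁻¹ • ∑ j, y j, z) - (s, fun _ => ζ))
      _ ≤ _ := le_add_of_nonneg_right (norm_nonneg _)

theorem norm_meanMap_sub_diagMap [NeZero N] (y : Fin N → Fin m → ℝ) (z : Fin N → Fin n → ℝ)
    (ζ : Fin n → ℝ) :
    ‖meanMap N m n (y, z) - diagMap N m n ((N : ℝ)⁻¹ • ∑ i, y i, ζ)‖ = ⨆ j, ‖z j - ζ‖ := by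
  rw [meanMap_apply, diagMap_apply, Prod.mk_sub_mk, sub_self, Prod.norm_mk, norm_zero,
    max_eq_right (norm_nonneg _)]
  refine le_antisymm ((pi_norm_le_iff_of_nonempty _).2 fun j => ?_) (ciSup_le fun j => ?_)
  · exact le_ciSup (f := fun j => ‖z j - ζ‖) (Set.finite_range _).bddAbove j
  · exact norm_le_pi_norm (z - fun _ => ζ) j

theorem exists_gain_norm_meanMap_sub_diagMap_le (hΓ : ∀ i t, t₀ ≤ t → ∀ w, IsUnit (A.Γ i t w))
    (hC : C.Admissible G t₀) {β : ℝ → ℝ → ℝ} {γ' w : ℝ → ℝ} {M : ℝ}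
    (hδ : IsDeltaISS t₀ A.perturbedBlended β γ') (hw_anti : AntitoneOn w (Ici 0))
    (hw_pos : ∀ t, 0 ≤ t → 0 < w t) (hM : 0 ≤ M) :
    ∃ γ, IsClassKInf γ ∧ ∀ {y : ℝ → Fin N → Fin m → ℝ} {z : ℝ → Fin N → Fin n → ℝ}
      {x : ℝ → (Fin m → ℝ) × (Fin n → ℝ)} {v : ℝ → ℝ} {ω : EReal} {T : ℝ}, t₀ ≤ T →
      (T : EReal) < ω → IsCaratheodorySolution (A.closedLoop G C) t₀ ω (fun t => (y t, z t)) →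
      IsCaratheodorySolution A.reducedBlended t₀ ω x → (∀ t ∈ Icc t₀ T, C.InFunnel G t (y t)) →
      (∀ t ∈ Icc t₀ T, ‖meanDeviation (y t)‖ ≤ v t ∧ v t ≤ M) →
      ‖meanMap N m n (y T, z T) - diagMap N m n (x T)‖ ≤
        β ‖meanMap N m n (y t₀, z t₀) - diagMap N m n (x t₀)‖ (T - t₀) +
          γ (fadingSup v w t₀ T) := by
  obtain ⟨γ, hγ, hfade⟩ := hδ.exists_fading_gain hw_anti hw_pos hM
  refine ⟨γ, hγ, fun {y z x v ω T} hT hTω hsol hx hfun hv => ?_⟩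
  have hac := hsol.1 T hT hTω
  have hacMean : AbsolutelyContinuousOnInterval (fun t => meanMap N m n (y t, z t)) t₀ T :=
    absolutelyContinuousOnInterval_lipschitzWith_comp hac (meanMap N m n).lipschitz
  have hacDiag : AbsolutelyContinuousOnInterval (fun t => diagMap N m n (x t)) t₀ T :=
    absolutelyContinuousOnInterval_lipschitzWith_comp (hx.1 T hT hTω) (diagMap N m n).lipschitz
  have hxcont : ContinuousOn (fun t => (y t, z t)) (Icc t₀ T) := by
    simpa only [uIcc_of_le hT] using hac.continuousOn
  have hcont : ContinuousOn (fun t => meanDeviation (y t)) (Icc t₀ T) :=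
    continuous_meanDeviation.comp_continuousOn (continuous_fst.comp_continuousOn hxcont)
  have hmean : IsCaratheodorySolution
      (fun t ξ => A.perturbedBlended t ξ (meanDeviation (y (min t T)))) t₀ T
      fun t => meanMap N m n (y t, z t) :=
    isCaratheodorySolution_meanMap hΓ hC (hsol.mono_right hTω.le)
      (fun t ht htT => hfun t ⟨ht.le, EReal.coe_le_coe_iff.1 htT.le⟩)
      fun t _ htT => by rw [min_eq_left (EReal.coe_le_coe_iff.1 htT.le)]
  have hdiag := isCaratheodorySolution_diagMap (N := N) (hx.mono_right hTω.le)
  have hdev : ∀ s ∈ Ico t₀ T, ‖meanDeviation (y (min s T)) - 0‖ ≤ v s := fun s hs => by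
    rw [sub_zero, min_eq_left hs.2.le]
    exact (hv s (Ico_subset_Icc_self hs)).1
  have hadm := isAdmissibleInput_comp_min hT hcont
  exact hfade (x := fun t => diagMap N m n (x t)) (x' := fun t => meanMap N m n (y t, z t)) hT
    isAdmissibleInput_zero hadm hdiag hacDiag hmean hacMean hdev
    fun s hs => (hv s (Ico_subset_Icc_self hs)).2

end AgentFamily

theorem corollary2_general {N m n : ℕ} {t₀ : ℝ} {A : AgentFamily N m n}
    {G : SimpleGraph (Fin N)} [DecidableRel G.Adj] {C : EdgeDesign N m}
    (hF : ∀ i, ∀ K : Set ((Fin m → ℝ) × (Fin n → ℝ)), IsCompact K →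
      ∃ M : ℝ, ∀ t, t₀ ≤ t → ∀ x ∈ K, ‖A.F i t x.1 x.2‖ ≤ M)
    (hΓ : ∀ i t, t₀ ≤ t → ∀ w, IsUnit (A.Γ i t w)) (hG : G.Connected) (hC : C.Admissible G t₀)
    {β : ℝ → ℝ → ℝ} {γ' : ℝ → ℝ} (hδ : IsDeltaISS t₀ A.perturbedBlended β γ')
    {w : ℝ → ℝ} (hw_anti : AntitoneOn w (Ici 0)) (hw_pos : ∀ t, 0 ≤ t → 0 < w t) :
    ∃ γ : ℝ → ℝ, IsClassKInf γ ∧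
      ∀ (ω : EReal) (y : ℝ → Fin N → Fin m → ℝ) (z : ℝ → Fin N → Fin n → ℝ)
        (s' : ℝ → Fin m → ℝ) (z' : ℝ → Fin n → ℝ),
        IsCaratheodorySolution (A.closedLoop G C) t₀ ω (fun t => (y t, z t)) →
        C.InFunnel G t₀ (y t₀) →
        IsCaratheodorySolution A.reducedBlended t₀ ω (fun t => (s' t, z' t)) →
        s' t₀ = (N : ℝ)⁻¹ • ∑ i, y t₀ i →
        ∀ (i : Fin N) (t : ℝ), t₀ ≤ t → (t : EReal) < ω →
          ‖(y t i, z t i) - (s' t, z' t)‖ ≤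
            β (⨆ j, ‖z t₀ j - z' t₀‖) (t - t₀) +
            γ (sSup ((fun s => G.diam * C.maxWidth G s * w (t - s)) '' Ico t₀ t)) +
            G.diam * C.maxWidth G t := by
  obtain ⟨M, hM₀, hM⟩ := hC.exists_maxWidth_le
  obtain ⟨γ, hγ, hmean⟩ := AgentFamily.exists_gain_norm_meanMap_sub_diagMap_le hΓ hC hδ hw_anti
    hw_pos (mul_nonneg (Nat.cast_nonneg G.diam) hM₀)
  refine ⟨γ, hγ, fun ω y z s' z' hsol h₀ hred hs₀ i t ht htω => ?_⟩
  have : NeZero N := ⟨i.pos.ne'⟩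
  have hfun : ∀ s ∈ Icc t₀ t, C.InFunnel G s (y s) :=
    AgentFamily.inFunnel_of_isCaratheodorySolution hF hΓ hC hsol h₀ ht htω
  have hdev : ∀ s ∈ Icc t₀ t, ‖meanDeviation (y s)‖ ≤ G.diam * C.maxWidth G s :=
    fun s hs => (hfun s hs).norm_meanDeviation_le hG
  have hest := hmean ht htω hsol hred hfun fun s hs =>
    ⟨hdev s hs, mul_le_mul_of_nonneg_left (hM s hs.1) (Nat.cast_nonneg _)⟩
  rw [hs₀, AgentFamily.norm_meanMap_sub_diagMap] at hest
  exact (AgentFamily.norm_sub_le_add_norm_meanMap_sub_diagMap _ _ _ _ i).trans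
    (add_le_add hest (hdev t (right_mem_Icc.2 ht)))

theorem corollary2 {N m n : ℕ} (t₀ : ℝ) (A : AgentFamily N m n)
    (G : SimpleGraph (Fin N)) [DecidableRel G.Adj] (C : EdgeDesign N m)
    (hA : A.OpenLoopAssumption t₀) (hΓ : A.GainAssumption t₀) (hG : G.Connected)
    (hC : C.Admissible G t₀) (hfin : NoFiniteEscape A G C t₀)
    (β : ℝ → ℝ → ℝ) (γ' : ℝ → ℝ) (hδ : IsDeltaISS t₀ A.perturbedBlended β γ')
    (w : ℝ → ℝ) (hw_anti : AntitoneOn w (Ici 0)) (hw_mem : ∀ t, 0 ≤ t → w t ∈ Ioc (0 : ℝ) 1)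
    (hw_lim : Tendsto w atTop (𝓝 0)) :
    ∃ γ : ℝ → ℝ, IsClassKInf γ ∧
      ∀ (ω : EReal) (y : ℝ → Fin N → Fin m → ℝ) (z : ℝ → Fin N → Fin n → ℝ)
        (s' : ℝ → Fin m → ℝ) (z' : ℝ → Fin n → ℝ),
        IsCaratheodorySolution (A.closedLoop G C) t₀ ω (fun t => (y t, z t)) →
        C.InFunnel G t₀ (y t₀) →
        IsCaratheodorySolution A.reducedBlended t₀ ω (fun t => (s' t, z' t)) →
        s' t₀ = (N : ℝ)⁻¹ • ∑ i, y t₀ i →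
        ∀ (i : Fin N) (t : ℝ), t₀ ≤ t → (t : EReal) < ω →
          ‖(y t i, z t i) - (s' t, z' t)‖ ≤
            β (⨆ j, ‖z t₀ j - z' t₀‖) (t - t₀) +
            γ (sSup ((fun s => G.diam * C.maxWidth G s * w (t - s)) '' Ico t₀ t)) +
            G.diam * C.maxWidth G t :=
  corollary2_general hA.F_bdd hΓ.isUnit hG hC hδ hw_anti fun t ht => (hw_mem t ht).1
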